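/- Let $\mathcal{E}$ be a finite-dimensional real inner product space, $\mathcal{M}\subset\mathcal{E}$ an embedded smooth submanifold, and $\mathsf{g}$ a metric operator on $\mathcal{M}$, that is, a smooth map $x\mapsto \mathsf{g}_x$ from $\mathcal{M}$ to the positive-definite self-adjoint operators on $\mathcal{E}$; it gives $\mathcal{M}$ the Riemannian metric $\langle\xi,\mathsf{g}_x\eta\rangle_{\mathcal{E}}$, $\xi,\eta\in T_x\mathcal{M}\subset\mathcal{E}$. Let $\mathfrak{q}:\mathcal{M}\to\mathcal{B}$ be a Riemannian submersion onto a Riemannian manifold $\mathcal{B}$: $\mathfrak{q}$ is smooth and onto, every $d\mathfrak{q}_x:T_x\mathcal{M}\to T_{\mathfrak{q}(x)}\mathcal{B}$ is onto, and $d\mathfrak{q}_x$ preserves inner products of vectors in the horizontal space $\mathcal{H}_x\mathcal{M}$, the orthogonal complement in $T_x\mathcal{M}$ of the vertical space $\mathcal{V}_x\mathcal{M}$ tangent to the fiber of $\mathfrak{q}$. Let $\mathrm{H}_x$ and $\mathrm{V}_x$ be the projections of $\mathcal{E}$ onto $\mathcal{H}_x\mathcal{M}$ and $\mathcal{V}_x\mathcal{M}$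 that are orthogonal for the inner product $\langle\cdot,\mathsf{g}_x\cdot\rangle_{\mathcal{E}}$, let $\mathrm{D}_\xi$ be the directional derivative along $\mathcal{M}$ in a tangent direction $\xi$, and let $\mathrm{A}_\xi\eta=(\mathrm{V}\nabla_{\xi}(\mathrm{H}c))_x$ be the O'Neil tensor, where $\nabla$ is the Levi-Civita connection of $\mathcal{M}$ and $c$ is any vector field with $c(x)=\eta$. Let $\mathcal{HM}=\{(x,v):x\in\mathcal{M},\ v\in\mathcal{H}_x\mathcal{M}\}\subset\mathcal{E}^2$, let $T\mathcal{HM}\subset\mathcal{E}^4$ be its tangent bundle, consisting of the quadruples $(x,v,\Delta_{\mathfrak m},\Delta_{\mathfrak t})$ with $(x,v)\in\mathcal{HM}$ and $(\Delta_{\mathfrak m},\Delta_{\mathfrak t})\in T_{(x,v)}\mathcal{HM}$, and let $\mathcal{QHM}$ be the set of those elements of $T\mathcal{HM}$ for which $\Delta_{\mathfrak m}\in\mathcal{H}_x\mathcal{M}$. Let $d\mathfrak{q}:\mathcal{HM}\to T\mathcal{B}$ be the differential of $\mathfrak{q}$ restricted to $\mathcal{HM}$ and $d^2\mathfrak{q}:T\mathcal{HM}\to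 TT\mathcal{B}$ its differential. Define $$\mathfrak{j}_{\mathcal H}(x,v,\Delta_{\mathfrak m},\Delta_{\mathfrak t})=\bigl(x,\ \mathrm{H}_x\Delta_{\mathfrak m},\ v,\ (\mathrm{D}_v\mathrm{H})_x\Delta_{\mathfrak m}+\mathrm{H}_x\Delta_{\mathfrak t}\bigr).$$ Then $\mathrm{H}$ is differentiable along $\mathcal{M}$, $d\mathfrak{q}$ is differentiable along $\mathcal{HM}$, and: 1. $\mathfrak{j}_{\mathcal H}$ maps $T\mathcal{HM}$ into $\mathcal{QHM}$. 2. For every $(x,v,\Delta_{\mathfrak m},\Delta_{\mathfrak t})\in T\mathcal{HM}$, with $\epsilon=\mathrm{V}_x\Delta_{\mathfrak m}$, $$\mathfrak{j}_{\mathcal H}(x,v,\Delta_{\mathfrak m},\Delta_{\mathfrak t})=\bigl(x,\ \mathrm{H}_x\Delta_{\mathfrak m},\ v,\ 2\mathrm{A}_v\Delta_{\mathfrak m}+\Delta_{\mathfrak t}-\{(\mathrm{D}_{\epsilon}\mathrm{H})_xv-(\mathrm{D}_v\mathrm{H})_x\epsilon\}\bigr);$$ in particular $\mathfrak{j}_{\mathcal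 H}(x,v,\delta_{\mathfrak m},\delta_{\mathfrak t})=(x,\mathrm{H}_x\delta_{\mathfrak m},v,2\mathrm{A}_v\delta_{\mathfrak m}+\delta_{\mathfrak t})$ for every $(x,v,\delta_{\mathfrak m},\delta_{\mathfrak t})\in\mathcal{QHM}$. 3. $\mathfrak{j}_{\mathcal H}\circ\mathfrak{j}_{\mathcal H}$ is the identity on $\mathcal{QHM}$. 4. On $\mathcal{QHM}$, $\mathfrak{j}_{\mathcal H}$ corresponds to the canonical flip of $TT\mathcal{B}$: if $d^2\mathfrak{q}$ maps $(x,v,\delta_{\mathfrak m},\delta_{\mathfrak t})\in\mathcal{QHM}$ to $(b,w,\delta_b,\delta_w)$, then it maps $\mathfrak{j}_{\mathcal H}(x,v,\delta_{\mathfrak m},\delta_{\mathfrak t})$ to $(b,\delta_b,w,\delta_w)$. -/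

import Mathlib

open scoped ContDiff Manifold Topology

noncomputable section

namespace HorizontalFlip

/-! ### Submanifolds of a Euclidean space, their tangent spaces and directional derivatives -/

/-- `M` is an embedded smooth submanifold of the vector space `V`: near each of its points there is
a smooth diffeomorphism between open subsets of `V` that carries `M` onto a piece of a linear
subspace. -/
def IsEmbeddedSubmanifold {V : Type*} [NormedAddCommGroup V] [NormedSpace ℝ V]
    (M : Set V) : Prop :=
  ∀ x ∈ M, ∃ (φ : OpenPartialHomeomorph V V) (L : Submodule ℝ V),
    x ∈ φ.source ∧ ContDiffOn ℝ ∞ φ φ.source ∧ ContDiffOn ℝ ∞ φ.symm φ.target ∧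
      ∀ y ∈ φ.source, (y ∈ M ↔ φ y ∈ L)

/-- `ξ` is the velocity at time `0` of a smooth curve `(-ε, ε) → S` through `p`. -/
def IsVelocityAt {V : Type*} [NormedAddCommGroup V] [NormedSpace ℝ V]
    (S : Set V) (p ξ : V) : Prop :=
  ∃ (ε : ℝ) (γ : ℝ → V), 0 < ε ∧ ContDiffOn ℝ ∞ γ (Set.Ioo (-ε) ε) ∧
    (∀ t ∈ Set.Ioo (-ε) ε, γ t ∈ S) ∧ γ 0 = p ∧ HasDerivAt γ ξ 0

/-- The tangent space at `p` to a subset `S` of a vector space, as a subspace of that vector space.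
(For an embedded submanifold the velocities of curves already form a subspace.) -/
def tangentAt {V : Type*} [NormedAddCommGroup V] [NormedSpace ℝ V]
    (S : Set V) (p : V) : Submodule ℝ V :=
  Submodule.span ℝ {ξ | IsVelocityAt S p ξ}

/-- The directional derivative `(D_ξ f)_x` of a function `f` defined along `M`. When `f` is
differentiable along `M`, its value on vectors `ξ` tangent to `M` at `x` depends only on the
restriction of `f` to `M` (see `dirDeriv_eq`). -/
def dirDeriv {V W : Type*} [NormedAddCommGroup V] [NormedSpace ℝ V]
    [NormedAddCommGroup W] [NormedSpace ℝ W] (M : Set V) (f : V → W) (x ξ : V) : W :=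
  fderivWithin ℝ f M x ξ

theorem dirDeriv_eq {V W : Type*} [NormedAddCommGroup V] [NormedSpace ℝ V]
    [NormedAddCommGroup W] [NormedSpace ℝ W] {M : Set V} {f : V → W} {f' : V →L[ℝ] W} {x ξ : V}
    (hf : HasFDerivWithinAt f f' M x) (hξ : ξ ∈ tangentAt M x) : dirDeriv M f x ξ = f' ξ := by
  have hvel : ∀ (L : V →L[ℝ] W), HasFDerivWithinAt f L M x → ∀ (ε : ℝ) (γ : ℝ → V) (ζ : V),
      0 < ε → (∀ t ∈ Set.Ioo (-ε) ε, γ t ∈ M) → γ 0 = x → HasDerivAt γ ζ 0 →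
      HasDerivAt (fun t => f (γ t)) (L ζ) 0 := by
    intro L hL ε γ ζ hε hM h0 hγ
    have hnhds : Set.Ioo (-ε) ε ∈ 𝓝 (0 : ℝ) := Ioo_mem_nhds (by linarith) hε
    subst h0
    exact (hL.comp_hasDerivWithinAt (0 : ℝ) hγ.hasDerivWithinAt hM).hasDerivAt hnhds
  unfold tangentAt at hξ
  unfold dirDeriv
  induction hξ using Submodule.span_induction with
  | mem ζ h =>
    obtain ⟨ε, γ, hε, -, hM, h0, hγ⟩ := h
    exact (hvel _ hf.differentiableWithinAt.hasFDerivWithinAt ε γ ζ hε hM h0 hγ).unique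
      (hvel _ hf ε γ ζ hε hM h0 hγ)
  | zero => simp
  | add a b _ _ ha hb => simp [ha, hb]
  | smul c a _ ha => simp [ha]

/-! ### Projections with respect to a positive-definite operator -/

/-- The projection of `E` onto its subspace `W` that is orthogonal for the inner product
`⟨u₁, G u₂⟩`, for a positive-definite operator `G`: it is `N (Nᵀ G N)⁻¹ Nᵀ G`, with `N` the
inclusion of `W` and `Nᵀ` its adjoint. -/
def metricProj {E : Type*} [NormedAddCommGroup E] [InnerProductSpace ℝ E] [FiniteDimensional ℝ E]
    (G : E →L[ℝ] E) (W : Submodule ℝ E) : E →L[ℝ] E :=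
  W.subtypeL ∘L Ring.inverse (W.orthogonalProjectionOnto ∘L G ∘L W.subtypeL) ∘L
    W.orthogonalProjectionOnto ∘L G

theorem metricProj_mem {E : Type*} [NormedAddCommGroup E] [InnerProductSpace ℝ E]
    [FiniteDimensional ℝ E] (G : E →L[ℝ] E) (W : Submodule ℝ E) (u : E) :
    metricProj G W u ∈ W := by
  simp [metricProj]

theorem inner_metricProj {E : Type*} [NormedAddCommGroup E] [InnerProductSpace ℝ E]
    [FiniteDimensional ℝ E] {G : E →L[ℝ] E} (hs : ∀ u w : E, inner ℝ (G u) w = inner ℝ u (G w))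
    (hp : ∀ u : E, u ≠ 0 → 0 < inner ℝ u (G u)) (W : Submodule ℝ E) (u : E) {η : E} (hη : η ∈ W) :
    inner ℝ (metricProj G W u) (G η) = inner ℝ u (G η) := by
  set C : W →L[ℝ] W := W.orthogonalProjectionOnto ∘L G ∘L W.subtypeL with hC
  have key : ∀ (u : E) (w : W), inner ℝ (W.orthogonalProjectionOnto u) w = inner ℝ u (w : E) := by
    intro u w
    simp
  have hinj : Function.Injective C := by
    rw [injective_iff_map_eq_zero]
    intro a ha
    by_contra hne
    have h0 : (a : E) ≠ 0 := fun h => hne (Subtype.ext h)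
    have h1 := hp a h0
    have h2 := key (G a) a
    have h3 : W.orthogonalProjectionOnto (G (a : E)) = 0 := ha
    rw [h3, inner_zero_left, hs] at h2
    linarith
  have hunit : IsUnit C := by
    have hb : Function.Bijective (C : W →ₗ[ℝ] W) :=
      ⟨hinj, LinearMap.injective_iff_surjective.1 hinj⟩
    let e := (LinearEquiv.ofBijective (C : W →ₗ[ℝ] W) hb).toContinuousLinearEquiv
    refine ⟨ContinuousLinearEquiv.toUnit e, ?_⟩
    ext a
    rfl
  have hinv : C (Ring.inverse C (W.orthogonalProjectionOnto (G u))) = W.orthogonalProjectionOnto (G u) := by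
    have := Ring.mul_inverse_cancel C hunit
    calc C (Ring.inverse C (W.orthogonalProjectionOnto (G u)))
        = (C * Ring.inverse C) (W.orthogonalProjectionOnto (G u)) := rfl
      _ = _ := by rw [this]; rfl
  have h4 : metricProj G W u = ((Ring.inverse C (W.orthogonalProjectionOnto (G u)) : W) : E) := rfl
  rw [h4, ← hs, ← hs]
  have h5 := key (G ((Ring.inverse C (W.orthogonalProjectionOnto (G u)) : W) : E)) ⟨η, hη⟩
  have h6 := key (G u) ⟨η, hη⟩
  exact (h5.symm.trans (congrArg (fun z : W => inner ℝ z (⟨η, hη⟩ : W)) hinv)).trans h6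

/-! ### Embedded ambient structures and the Levi-Civita connection -/

/-- An embedded ambient structure `(M, g, E)`: a submanifold `M` of a Euclidean space `E` with a
metric operator, a smooth family of positive-definite operators of `E` along `M`. The Riemannian
metric of `M` is `⟨ξ, η⟩_g = ⟨ξ, g_x η⟩` on each tangent space. Values of `g` off `M` are
irrelevant. -/
structure EmbeddedAmbient (E : Type*) [NormedAddCommGroup E] [InnerProductSpace ℝ E]
    [FiniteDimensional ℝ E] where
  /-- the manifold -/
  M : Set E
  isSubmanifold : IsEmbeddedSubmanifold M
  /-- the metric operator -/
  g : E → E →L[ℝ] E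
  g_smooth : ContDiffOn ℝ ∞ g M
  g_symm : ∀ x ∈ M, ∀ u w : E, inner ℝ (g x u) w = inner ℝ u (g x w)
  g_pos : ∀ x ∈ M, ∀ u : E, u ≠ 0 → 0 < inner ℝ u (g x u)

namespace EmbeddedAmbient

variable {E : Type*} [NormedAddCommGroup E] [InnerProductSpace ℝ E] [FiniteDimensional ℝ E]

/-- The projection `Π_{g,x}` of `E` onto the tangent space of `M` at `x`. -/
def tangentProj (A : EmbeddedAmbient E) (x : E) : E →L[ℝ] E :=
  metricProj (A.g x) (tangentAt A.M x)

/-- The vector `X(ξ, η)_x` with `⟨X(ξ, η)_x, φ⟩ = ⟨(D_φ g)_x ξ, η⟩`. -/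
def dualTerm (A : EmbeddedAmbient E) (x ξ η : E) : E :=
  ContinuousLinearMap.adjoint ((fderivWithin ℝ A.g A.M x).flip ξ) η

/-- The covariant derivative `(∇_ξ Y)_x` of a vector field `Y` of `M` in the direction of a tangent
vector `ξ` at `x`, for the Levi-Civita connection of the metric induced by `g`, namely
`Π_{g,x} (D_ξ Y + ½ g_x⁻¹ ((D_ξ g) Y + (D_Y g) ξ - X(ξ, Y)))`. That it is tangent to `M`, torsion-free
and compatible with the metric is checked in `covDeriv_mem`, `covDeriv_sub_covDeriv` and
`covDeriv_compat`. -/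
def covDeriv (A : EmbeddedAmbient E) (ξ : E) (Y : E → E) (x : E) : E :=
  A.tangentProj x (dirDeriv A.M Y x ξ +
    (1 / 2 : ℝ) • Ring.inverse (A.g x)
      (dirDeriv A.M A.g x ξ (Y x) + dirDeriv A.M A.g x (Y x) ξ - A.dualTerm x ξ (Y x)))

theorem covDeriv_mem (A : EmbeddedAmbient E) (ξ : E) (Y : E → E) (x : E) :
    A.covDeriv ξ Y x ∈ tangentAt A.M x :=
  metricProj_mem _ _ _

theorem g_inverse (A : EmbeddedAmbient E) {x : E} (hx : x ∈ A.M) (u : E) :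
    A.g x (Ring.inverse (A.g x) u) = u := by
  have hinj : Function.Injective (A.g x) := by
    rw [injective_iff_map_eq_zero]
    intro a ha
    by_contra hne
    have := A.g_pos x hx a hne
    rw [ha, inner_zero_right] at this
    exact lt_irrefl _ this
  have hunit : IsUnit (A.g x) := by
    have hb : Function.Bijective (A.g x : E →ₗ[ℝ] E) :=
      ⟨hinj, LinearMap.injective_iff_surjective.1 hinj⟩
    let e := (LinearEquiv.ofBijective (A.g x : E →ₗ[ℝ] E) hb).toContinuousLinearEquiv
    refine ⟨ContinuousLinearEquiv.toUnit e, ?_⟩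
    ext a
    rfl
  have := Ring.mul_inverse_cancel (A.g x) hunit
  calc A.g x (Ring.inverse (A.g x) u) = (A.g x * Ring.inverse (A.g x)) u := rfl
    _ = u := by rw [this]; rfl

theorem inner_covDeriv (A : EmbeddedAmbient E) {x : E} (hx : x ∈ A.M) (ξ : E) (Y : E → E)
    {φ : E} (hφ : φ ∈ tangentAt A.M x) :
    inner ℝ (A.covDeriv ξ Y x) (A.g x φ) =
      inner ℝ (dirDeriv A.M Y x ξ) (A.g x φ) +
        (1 / 2 : ℝ) * (inner ℝ (dirDeriv A.M A.g x ξ (Y x)) φ +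
          inner ℝ (dirDeriv A.M A.g x (Y x) ξ) φ - inner ℝ (dirDeriv A.M A.g x φ ξ) (Y x)) := by
  have hd : inner ℝ (A.dualTerm x ξ (Y x)) φ = inner ℝ (dirDeriv A.M A.g x φ ξ) (Y x) := by
    rw [dualTerm, ContinuousLinearMap.adjoint_inner_left, real_inner_comm]
    rfl
  rw [covDeriv, tangentProj, inner_metricProj (A.g_symm x hx) (A.g_pos x hx) _ _ hφ,
    inner_add_left, real_inner_smul_left, ← A.g_symm x hx (Ring.inverse (A.g x) _) φ,
    A.g_inverse hx, inner_sub_left, inner_add_left, hd]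

theorem dirDeriv_g_symm (A : EmbeddedAmbient E) {x φ : E} (hx : x ∈ A.M)
    (hφ : φ ∈ tangentAt A.M x) (u w : E) :
    inner ℝ (dirDeriv A.M A.g x φ u) w = inner ℝ (dirDeriv A.M A.g x φ w) u := by
  have hg : HasFDerivWithinAt A.g (fderivWithin ℝ A.g A.M x) A.M x :=
    ((A.g_smooth x hx).differentiableWithinAt (by simp)).hasFDerivWithinAt
  have h1 := (hg.clm_apply (hasFDerivWithinAt_const u x A.M)).inner ℝ
    (hasFDerivWithinAt_const w x A.M)
  have h2 := (hg.clm_apply (hasFDerivWithinAt_const w x A.M)).inner ℝ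
    (hasFDerivWithinAt_const u x A.M)
  have h3 : HasFDerivWithinAt (fun y => inner ℝ (A.g y u) w) _ A.M x :=
    h2.congr (fun y hy => by rw [A.g_symm y hy, real_inner_comm])
      (by rw [A.g_symm x hx, real_inner_comm])
  have h4 := (dirDeriv_eq h1 hφ).symm.trans (dirDeriv_eq h3 hφ)
  simpa [dirDeriv, fderivInnerCLM_apply] using h4

theorem eq_of_inner_g (A : EmbeddedAmbient E) {x a b : E} (hx : x ∈ A.M)
    (ha : a ∈ tangentAt A.M x) (hb : b ∈ tangentAt A.M x)
    (h : ∀ φ ∈ tangentAt A.M x, inner ℝ a (A.g x φ) = inner ℝ b (A.g x φ)) : a = b := by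
  by_contra hne
  have h1 := A.g_pos x hx (a - b) (sub_ne_zero.2 hne)
  have h2 := h (a - b) (Submodule.sub_mem _ ha hb)
  rw [inner_sub_left, h2, sub_self] at h1
  exact lt_irrefl _ h1

/-- The connection is torsion-free (the bracket `D_X Y - D_Y X` of two vector fields of `M` is
tangent to `M`, hence fixed by `Π`). -/
theorem covDeriv_sub_covDeriv (A : EmbeddedAmbient E) {x : E} (hx : x ∈ A.M) (X Y : E → E) :
    A.covDeriv (X x) Y x - A.covDeriv (Y x) X x =
      A.tangentProj x (dirDeriv A.M Y x (X x) - dirDeriv A.M X x (Y x)) := by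
  refine A.eq_of_inner_g hx (Submodule.sub_mem _ (A.covDeriv_mem _ _ _) (A.covDeriv_mem _ _ _))
    (metricProj_mem _ _ _) ?_
  intro φ hφ
  rw [tangentProj, inner_metricProj (A.g_symm x hx) (A.g_pos x hx) _ _ hφ, inner_sub_left,
    inner_sub_left, A.inner_covDeriv hx _ _ hφ, A.inner_covDeriv hx _ _ hφ,
    A.dirDeriv_g_symm hx hφ (X x) (Y x)]
  ring

/-- The connection is compatible with the Riemannian metric. -/
theorem covDeriv_compat (A : EmbeddedAmbient E) {x ξ : E} (hx : x ∈ A.M)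
    (hξ : ξ ∈ tangentAt A.M x) (Y Z : E → E)
    (hY : DifferentiableWithinAt ℝ Y A.M x) (hZ : DifferentiableWithinAt ℝ Z A.M x)
    (hYx : Y x ∈ tangentAt A.M x) (hZx : Z x ∈ tangentAt A.M x) :
    dirDeriv A.M (fun y => inner ℝ (Y y) (A.g y (Z y))) x ξ =
      inner ℝ (A.covDeriv ξ Y x) (A.g x (Z x)) + inner ℝ (Y x) (A.g x (A.covDeriv ξ Z x)) := by
  have hg : HasFDerivWithinAt A.g (fderivWithin ℝ A.g A.M x) A.M x :=
    ((A.g_smooth x hx).differentiableWithinAt (by simp)).hasFDerivWithinAt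
  have h1 := hY.hasFDerivWithinAt.inner ℝ (hg.clm_apply hZ.hasFDerivWithinAt)
  rw [dirDeriv_eq h1 hξ, ← A.g_symm x hx (Y x), real_inner_comm (A.covDeriv ξ Z x),
    A.inner_covDeriv hx ξ Y hZx, A.inner_covDeriv hx ξ Z hYx,
    A.dirDeriv_g_symm hx hξ (Z x) (Y x), A.dirDeriv_g_symm hx hYx ξ (Z x),
    A.dirDeriv_g_symm hx hZx ξ (Y x)]
  have h2 := A.dirDeriv_g_symm hx hξ (Z x) (Y x)
  have h3 := A.g_symm x hx (Y x) (dirDeriv A.M Z x ξ)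
  simp only [dirDeriv] at h2 h3 ⊢
  simp [fderivInnerCLM_apply, inner_add_right, real_inner_comm] at h2 h3 ⊢
  linarith

end EmbeddedAmbient

/-! ### Riemannian submersions -/

/-- The differential at `x ∈ M` of a map `q : M → B`, on vectors tangent to `M` at `x`. As for
`dirDeriv`, its values on these depend only on the restriction of `q` to `M`. -/
def submersionDeriv {E F B : Type*} [NormedAddCommGroup E] [NormedSpace ℝ E]
    [NormedAddCommGroup F] [NormedSpace ℝ F] [TopologicalSpace B] [ChartedSpace F B]
    (M : Set E) (q : E → B) (x : E) (ξ : E) : TangentSpace 𝓘(ℝ, F) (q x) :=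
  mfderivWithin 𝓘(ℝ, E) 𝓘(ℝ, F) q M x ξ

/-- The vertical space at `x`: the tangent space of the fiber of `q` through `x`. -/
def verticalSpace {E B : Type*} [NormedAddCommGroup E] [NormedSpace ℝ E]
    (M : Set E) (q : E → B) (x : E) : Submodule ℝ E :=
  tangentAt {y ∈ M | q y = q x} x

/-- The horizontal space at `x`: the orthogonal complement, inside the tangent space of `M` at `x`
with its Riemannian inner product, of the vertical space. -/
def horizontalSpace {E B : Type*} [NormedAddCommGroup E] [InnerProductSpace ℝ E]
    [FiniteDimensional ℝ E] (A : EmbeddedAmbient E) (q : E → B) (x : E) : Submodule ℝ E where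
  carrier := {ξ | ξ ∈ tangentAt A.M x ∧ ∀ η ∈ verticalSpace A.M q x, inner ℝ η (A.g x ξ) = 0}
  add_mem' := fun ha hb => ⟨Submodule.add_mem _ ha.1 hb.1, fun η hη => by
    rw [map_add, inner_add_right, ha.2 η hη, hb.2 η hη, add_zero]⟩
  zero_mem' := ⟨Submodule.zero_mem _, fun η _ => by rw [map_zero, inner_zero_right]⟩
  smul_mem' := fun c _ ha => ⟨Submodule.smul_mem _ c ha.1, fun η hη => by
    rw [map_smul, inner_smul_right, ha.2 η hη, mul_zero]⟩

/-- A submersed ambient structure `(M, q, B, g, E)`: an embedded ambient structure `(M, g, E)`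
together with a Riemannian submersion `q` of `M` onto a Riemannian manifold `B` (modelled on `F`).
Values of `q` off `M` are irrelevant. -/
structure SubmersedAmbient (E F B : Type*) [NormedAddCommGroup E] [InnerProductSpace ℝ E]
    [FiniteDimensional ℝ E] [NormedAddCommGroup F] [NormedSpace ℝ F] [TopologicalSpace B]
    [ChartedSpace F B] [IsManifold 𝓘(ℝ, F) ∞ B] extends EmbeddedAmbient E where
  /-- the Riemannian metric of the base -/
  metricB : Bundle.ContMDiffRiemannianMetric 𝓘(ℝ, F) ∞ F
    (fun b : B => TangentSpace 𝓘(ℝ, F) b)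
  /-- the submersion -/
  q : E → B
  q_smooth : ContMDiffOn 𝓘(ℝ, E) 𝓘(ℝ, F) ∞ q M
  q_onto : q '' M = Set.univ
  deriv_onto : ∀ x ∈ M, ∀ w : TangentSpace 𝓘(ℝ, F) (q x),
    ∃ ξ ∈ tangentAt M x, submersionDeriv (F := F) M q x ξ = w
  deriv_isometry : ∀ x ∈ M, ∀ ξ ∈ horizontalSpace toEmbeddedAmbient q x,
    ∀ η ∈ horizontalSpace toEmbeddedAmbient q x,
      metricB.inner (q x) (submersionDeriv M q x ξ) (submersionDeriv M q x η) = inner ℝ ξ (g x η)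

namespace SubmersedAmbient

variable {E F B : Type*} [NormedAddCommGroup E] [InnerProductSpace ℝ E] [FiniteDimensional ℝ E]
  [NormedAddCommGroup F] [NormedSpace ℝ F] [TopologicalSpace B] [ChartedSpace F B]
  [IsManifold 𝓘(ℝ, F) ∞ B]

/-- The horizontal projection, as an operator-valued function of the point. -/
def hProj (S : SubmersedAmbient E F B) (x : E) : E →L[ℝ] E :=
  metricProj (S.g x) (horizontalSpace S.toEmbeddedAmbient S.q x)

/-- The vertical projection. -/
def vProj (S : SubmersedAmbient E F B) (x : E) : E →L[ℝ] E :=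
  metricProj (S.g x) (verticalSpace S.M S.q x)

/-- The derivative `(D_ξ H)_x`, an operator on `E`, of the horizontal projection along `M`. -/
def derivHProj (S : SubmersedAmbient E F B) (x ξ : E) : E →L[ℝ] E :=
  dirDeriv S.M S.hProj x ξ

/-- The O'Neil tensor `A_ξ η = (V ∇_ξ (H c))_x`, for a vector field `c` of `M` with `c(x) = η`; the
value does not depend on `c`, which is taken to be `y ↦ Π_y η`. -/
def oneil (S : SubmersedAmbient E F B) (x ξ η : E) : E :=
  S.vProj x (S.covDeriv ξ (fun y => S.hProj y (S.tangentProj y η)) x)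

/-- The horizontal bundle, as a subset of `E²`. -/
def HM (S : SubmersedAmbient E F B) : Set (E × E) :=
  {p | p.1 ∈ S.M ∧ p.2 ∈ horizontalSpace S.toEmbeddedAmbient S.q p.1}

/-- The tangent bundle of the horizontal bundle, as a set of quadruples `(x, v, Δ_m, Δ_t)`: the
vector `(Δ_m, Δ_t)` is tangent to the horizontal bundle at `(x, v)`. -/
def THM (S : SubmersedAmbient E F B) : Set (E × E × E × E) :=
  {p | (p.1, p.2.1) ∈ S.HM ∧ (p.2.2.1, p.2.2.2) ∈ tangentAt S.HM (p.1, p.2.1)}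

/-- The subbundle `QHM` of `THM`: the vectors tangent to the horizontal bundle that are sent to
horizontal vectors of `M` by the differential `(Δ_m, Δ_t) ↦ Δ_m` of the bundle projection. -/
def QHM (S : SubmersedAmbient E F B) : Set (E × E × E × E) :=
  {p | p ∈ S.THM ∧ p.2.2.1 ∈ horizontalSpace S.toEmbeddedAmbient S.q p.1}

/-- The map `j_H : (x, v, Δ_m, Δ_t) ↦ (x, H Δ_m, v, (D_v H) Δ_m + H Δ_t)`. -/
def jH (S : SubmersedAmbient E F B) (p : E × E × E × E) : E × E × E × E :=
  (p.1, S.hProj p.1 p.2.2.1, p.2.1,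
    S.derivHProj p.1 p.2.1 p.2.2.1 + S.hProj p.1 p.2.2.2)

/-- The differential `dq`, `(x, v) ↦ (q x, dq_x v)`, with values in the tangent bundle of `B`. -/
def dq (S : SubmersedAmbient E F B) (p : E × E) : TangentBundle 𝓘(ℝ, F) B :=
  ⟨S.q p.1, submersionDeriv S.M S.q p.1 p.2⟩

/-- The differential `d²q` of the restriction of `dq` to the horizontal bundle, on quadruples in the
tangent bundle of the horizontal bundle, with values in the double tangent bundle of `B`. -/
def d2q (S : SubmersedAmbient E F B) (p : E × E × E × E) :
    TangentBundle 𝓘(ℝ, F).tangent (TangentBundle 𝓘(ℝ, F) B) :=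
  ⟨S.dq (p.1, p.2.1),
    mfderivWithin 𝓘(ℝ, E × E) 𝓘(ℝ, F).tangent S.dq S.HM (p.1, p.2.1) (p.2.2.1, p.2.2.2)⟩

end SubmersedAmbient

/-- The canonical flip `(b, w, δ_b, δ_w) ↦ (b, δ_b, w, δ_w)` of the double tangent bundle of a
manifold `B`. Mathlib represents a vector tangent to `B` at `b` by its coordinates in the preferred
chart of `B` at `b`, and a vector tangent to `TB` at any `(b, w)` by its coordinates in the chart of
`TB` that this same chart of `B` induces; so the four components are the coordinates of a point of
the double tangent bundle in one chart, and the flip exchanges the two in the middle. -/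
def canonicalFlip {F B : Type*} [NormedAddCommGroup F] [NormedSpace ℝ F] [TopologicalSpace B]
    [ChartedSpace F B] [IsManifold 𝓘(ℝ, F) ∞ B]
    (p : TangentBundle 𝓘(ℝ, F).tangent (TangentBundle 𝓘(ℝ, F) B)) :
    TangentBundle 𝓘(ℝ, F).tangent (TangentBundle 𝓘(ℝ, F) B) :=
  let b : B := p.proj.proj
  let w : F := p.proj.snd
  let δ : F × F := p.snd
  ⟨(⟨b, (δ.1 : F)⟩ : TangentBundle 𝓘(ℝ, F) B), ((w, δ.2) : F × F)⟩

end HorizontalFlip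

end

noncomputable section

namespace HorizontalFlip

/-! ### The inverse function theorem on a neighbourhood and curves in level sets -/

/-! Read `q` near a point as a smooth map `ψ` (`coord`) from an open set of `E` to `F`, by composing
a retraction onto `M`, `q` and a chart of `B`. On `M` the vertical space is the kernel of `ψ'`
inside the tangent space (`mem_verticalSpace_iff`), so all projections are smooth: `metricProj` is a
smooth function of the metric operator and of any smooth family of linear projections onto the
subspaces (`contDiffOn_metricProj`).

Differentiating `H ∘ H = H` gives `DH = DH ∘ H + H ∘ DH`, and `HM` is cut out by `v = H v`, so `(a,
b)` is tangent to it exactly when `a` is tangent to `M` and `b = (D_a H) v + H b`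
(`mem_tangentAt_HM_iff`). These two identities give the range of `j_H` and the involution.

The geometric input is `A_v v = 0` (`inner_derivHProj_self`), which uses that `q` is isometric on
horizontal vectors. Polarized, it makes `A` alternating on horizontal vectors; as the connection is
torsion-free, `2 A_v δ` is then the vertical bracket `(D_v H) δ - (D_δ H) v` (`two_smul_oneil`),
whence the formulas for `j_H`.

For the flip, `d²q` sends `(x, v, a, c)` to `(ψ x, ψ' v, ψ' a, ψ''(a, v) + ψ' c)` in coordinates. On
`QHM`, `j_H` exchanges `v` and `a` and adds the vertical vector `2 A_v a` to `c`: `ψ'` kills the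
latter and `ψ''` is symmetric. -/

theorem exists_contDiffOn_localInverse {G G' : Type*} [NormedAddCommGroup G] [NormedSpace ℝ G]
    [CompleteSpace G] [NormedAddCommGroup G'] [NormedSpace ℝ G'] {Θ : G → G'} {U : Set G} {a : G}
    (hU : IsOpen U) (ha : a ∈ U) (hΘ : ContDiffOn ℝ ∞ Θ U) (e : G ≃L[ℝ] G')
    (he : HasFDerivAt Θ (e : G →L[ℝ] G') a) :
    ∃ (W : Set G') (σ : G' → G), IsOpen W ∧ Θ a ∈ W ∧ ContDiffOn ℝ ∞ σ W ∧ σ (Θ a) = a ∧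
      Set.MapsTo σ W U ∧ (∀ z ∈ W, Θ (σ z) = z) ∧
      HasFDerivAt σ (e.symm : G' →L[ℝ] G) (Θ a) := by
  have hat : ∀ y ∈ U, ContDiffAt ℝ ∞ Θ y := fun y hy => hΘ.contDiffAt (hU.mem_nhds hy)
  set h : OpenPartialHomeomorph G G' := (hat a ha).toOpenPartialHomeomorph Θ he (by simp) with hh
  have hcoe : (h : G → G') = Θ := rfl
  have hsrc : a ∈ h.source := (hat a ha).mem_toOpenPartialHomeomorph_source he (by simp)
  -- Invertible operators form an open set and `Θ'` is continuous, so the derivative is invertible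
  -- near `a` and the local inverse is smooth on a neighbourhood, not only at `Θ a`.
  have hgood : ∀ᶠ y in 𝓝 a, fderiv ℝ Θ y ∈ Set.range ((↑) : (G ≃L[ℝ] G') → G →L[ℝ] G') := by
    have hc : ContinuousAt (fderiv ℝ Θ) a :=
      ((hat a ha).fderiv_right (m := 0) (by simp)).continuousAt
    have := ContinuousLinearEquiv.nhds e
    rw [← he.fderiv] at this
    exact hc this
  obtain ⟨N, hN, hNo, haN⟩ := mem_nhds_iff.1 (Filter.inter_mem hgood (hU.mem_nhds ha))
  have hsymm : h.symm (Θ a) = a := h.left_inv hsrc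
  refine ⟨h.target ∩ h.symm ⁻¹' N, h.symm, h.symm.isOpen_inter_preimage hNo,
    ⟨h.map_source hsrc, by simpa [hsymm] using haN⟩, ?_, hsymm, fun z hz => (hN hz.2).2,
    fun z hz => h.right_inv hz.1, ?_⟩
  · intro z hz
    obtain ⟨e', he'⟩ := (hN hz.2).1
    have hd : HasFDerivAt h (e' : G →L[ℝ] G') (h.symm z) := by
      rw [he']
      exact ((hat _ (hN hz.2).2).differentiableAt (by simp)).hasFDerivAt
    exact (h.contDiffAt_symm hz.1 hd (hat _ (hN hz.2).2)).contDiffWithinAt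
  · refine h.hasFDerivAt_symm (h.map_source hsrc) ?_
    rw [hsymm, hcoe]
    exact he

/-- A vector in the kernel of a surjective differential is the velocity of a curve in the level
set. -/
theorem isVelocityAt_levelSet {E F : Type*} [NormedAddCommGroup E] [NormedSpace ℝ E]
    [NormedAddCommGroup F] [NormedSpace ℝ F] [FiniteDimensional ℝ F] {ψ : E → F} {U : Set E}
    {x ξ : E} (hU : IsOpen U) (hx : x ∈ U) (hψ : ContDiffOn ℝ ∞ ψ U) {K : F →L[ℝ] E}
    (hK : fderiv ℝ ψ x ∘L K = ContinuousLinearMap.id ℝ F) (hξ : fderiv ℝ ψ x ξ = 0) :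
    IsVelocityAt {y ∈ U | ψ y = ψ x} x ξ := by
  set ℓ : ℝ × F → E := fun p => x + p.1 • ξ + K p.2 with hℓ
  have hℓs : ContDiff ℝ ∞ ℓ := by fun_prop
  have hℓ0 : ℓ 0 = x := by simp [hℓ]
  -- Since `ψ' ξ = 0` and `ψ' K = id`, the derivative of `Θ` at `0` is the identity. The curve
  -- sought is the image under `ℓ` of the preimage by `Θ` of the line `t ↦ (t, ψ x)`.
  set Θ : ℝ × F → ℝ × F := fun p => (p.1, ψ (ℓ p)) with hΘ
  have hU' : IsOpen (ℓ ⁻¹' U) := hU.preimage hℓs.continuous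
  have hΘs : ContDiffOn ℝ ∞ Θ (ℓ ⁻¹' U) :=
    contDiffOn_fst.prodMk (hψ.comp hℓs.contDiffOn (fun p hp => hp))
  have hψd : HasFDerivAt ψ (fderiv ℝ ψ x) (ℓ 0) := by
    rw [hℓ0]
    exact ((hψ.contDiffAt (hU.mem_nhds hx)).differentiableAt (by simp)).hasFDerivAt
  have hℓd : HasFDerivAt ℓ ((ContinuousLinearMap.fst ℝ ℝ F).smulRight ξ +
      K ∘L ContinuousLinearMap.snd ℝ ℝ F) 0 := by
    have h1 : HasFDerivAt (fun p : ℝ × F => p.1 • ξ)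
      ((ContinuousLinearMap.fst ℝ ℝ F).smulRight ξ) 0 :=
      ((ContinuousLinearMap.fst ℝ ℝ F).smulRight ξ).hasFDerivAt
    have h2 : HasFDerivAt (fun p : ℝ × F => K p.2) (K ∘L ContinuousLinearMap.snd ℝ ℝ F) 0 :=
      (K ∘L ContinuousLinearMap.snd ℝ ℝ F).hasFDerivAt
    exact (h1.const_add x).add h2
  have hΘd : HasFDerivAt Θ
      ((ContinuousLinearEquiv.refl ℝ (ℝ × F) : (ℝ × F) ≃L[ℝ] ℝ × F) : ℝ × F →L[ℝ] ℝ × F) 0 := by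
    refine (hasFDerivAt_fst.prodMk (hψd.comp 0 hℓd)).congr_fderiv ?_
    ext p
    · simp
    · simp [hξ]
    · simp
    · simpa using DFunLike.congr_fun hK p
  obtain ⟨W, σ, hWo, hW, hσ, hσ0, hσU, hσΘ, hσd⟩ := exists_contDiffOn_localInverse hU'
    (by simpa [hℓ0] using hx) hΘs _ hΘd
  have hΘ0 : Θ 0 = (0, ψ x) := by simp [hΘ, hℓ0]
  rw [hΘ0] at hW hσ0 hσd
  have hline : Continuous fun t : ℝ => (t, ψ x) := by fun_prop
  obtain ⟨ε, hε, hball⟩ := Metric.isOpen_iff.1 (hWo.preimage hline) 0 hW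
  rw [Real.ball_eq_Ioo, zero_sub, zero_add] at hball
  refine ⟨ε, fun t => ℓ (σ (t, ψ x)), hε, ?_, ?_, ?_, ?_⟩
  · exact hℓs.comp_contDiffOn (hσ.comp (by fun_prop) hball)
  · intro t ht
    refine ⟨hσU (hball ht), ?_⟩
    exact congrArg Prod.snd (hσΘ _ (hball ht))
  · change ℓ (σ (0, ψ x)) = x
    rw [hσ0, hℓ0]
  · have h1 : HasDerivAt (fun t : ℝ => (t, ψ x)) (1, 0) 0 :=
      (hasDerivAt_id 0).prodMk (hasDerivAt_const _ _)
    have h2 := hσd.comp_hasDerivAt (0 : ℝ) h1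
    have h3 := HasFDerivAt.comp_hasDerivAt (0 : ℝ) (l := ℓ) (by simpa [hσ0] using hℓd) h2
    exact h3.congr_deriv (by simp)

/-! ### Smooth retractions onto a submanifold -/

/-- A smooth map `r` of the open set `U` into `M` that is the identity on `M`. -/
structure IsRetractionOn {E : Type*} [NormedAddCommGroup E] [NormedSpace ℝ E]
    (M U : Set E) (r : E → E) : Prop where
  isOpen : IsOpen U
  contDiffOn : ContDiffOn ℝ ∞ r U
  mapsTo : Set.MapsTo r U M
  eq_self : ∀ y ∈ M, y ∈ U → r y = y

/-- In a straightening chart `φ` with model subspace `L`, project orthogonally to `L` and return by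
`φ.symm`, on the open set where the projection stays in the target. -/
theorem IsEmbeddedSubmanifold.exists_retraction {E : Type*} [NormedAddCommGroup E]
    [InnerProductSpace ℝ E] [FiniteDimensional ℝ E] {M : Set E} (hM : IsEmbeddedSubmanifold M)
    {x : E} (hx : x ∈ M) : ∃ (U : Set E) (r : E → E), IsRetractionOn M U r ∧ x ∈ U := by
  obtain ⟨φ, L, hxs, hφ, hφs, hL⟩ := hM x hx
  have hfix : ∀ y ∈ φ.source, y ∈ M → L.starProjection (φ y) = φ y := fun y hy hyM =>
    Submodule.starProjection_eq_self_iff.2 ((hL y hy).1 hyM)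
  have hc : ContinuousOn (fun y => L.starProjection (φ y)) φ.source :=
    L.starProjection.continuous.comp_continuousOn φ.continuousOn
  refine ⟨φ.source ∩ (fun y => L.starProjection (φ y)) ⁻¹' φ.target,
    fun y => φ.symm (L.starProjection (φ y)), ⟨hc.isOpen_inter_preimage φ.open_source φ.open_target,
      ?_, ?_, ?_⟩, hxs, ?_⟩
  · exact hφs.comp (L.starProjection.contDiff.comp_contDiffOn (hφ.mono Set.inter_subset_left))
      (fun y hy => hy.2)
  · intro y hy
    refine (hL _ (φ.map_target hy.2)).2 ?_
    rw [φ.right_inv hy.2]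
    exact Submodule.starProjection_apply_mem L _
  · intro y hyM hy
    rw [hfix y hy.1 hyM, φ.left_inv hy.1]
  · change L.starProjection (φ x) ∈ φ.target
    rw [hfix x hxs hx]
    exact φ.map_source hxs

/-! ### Calculus along a set -/

section Along

variable {V W W' : Type*} [NormedAddCommGroup V] [NormedSpace ℝ V]
  [NormedAddCommGroup W] [NormedSpace ℝ W] [NormedAddCommGroup W'] [NormedSpace ℝ W']
  {M : Set V} {x ξ : V}

theorem dirDeriv_congr {f g : V → W} (h : ∀ y ∈ M, f y = g y) (hx : x ∈ M) :
    dirDeriv M f x ξ = dirDeriv M g x ξ := by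
  rw [dirDeriv, dirDeriv, fderivWithin_congr h (h x hx)]

theorem dirDeriv_eq_of_eventuallyEq {f g : V → W} {f' : V →L[ℝ] W} (hx : x ∈ M)
    (h : ∀ᶠ y in 𝓝[M] x, f y = g y) (hg : HasFDerivWithinAt g f' M x)
    (hξ : ξ ∈ tangentAt M x) : dirDeriv M f x ξ = f' ξ :=
  dirDeriv_eq (hg.congr_of_eventuallyEq h (h.self_of_nhdsWithin hx)) hξ

theorem dirDeriv_const (c : W) (hξ : ξ ∈ tangentAt M x) : dirDeriv M (fun _ => c) x ξ = 0 :=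
  dirDeriv_eq (hasFDerivWithinAt_const c x M) hξ

theorem dirDeriv_of_eventually_const {f : V → W} (hx : x ∈ M)
    (h : ∀ᶠ y in 𝓝[M] x, f y = f x) (hξ : ξ ∈ tangentAt M x) : dirDeriv M f x ξ = 0 :=
  dirDeriv_eq_of_eventuallyEq hx h (hasFDerivWithinAt_const (f x) x M) hξ

theorem dirDeriv_of_hasFDerivAt {f : V → W} {f' : V →L[ℝ] W} (hf : HasFDerivAt f f' x)
    (hξ : ξ ∈ tangentAt M x) : dirDeriv M f x ξ = f' ξ :=
  dirDeriv_eq hf.hasFDerivWithinAt hξ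

theorem dirDeriv_clm_apply {A : V → W →L[ℝ] W'} {Y : V → W}
    (hA : DifferentiableWithinAt ℝ A M x) (hY : DifferentiableWithinAt ℝ Y M x)
    (hξ : ξ ∈ tangentAt M x) :
    dirDeriv M (fun y => A y (Y y)) x ξ = dirDeriv M A x ξ (Y x) + A x (dirDeriv M Y x ξ) := by
  rw [dirDeriv_eq (hA.hasFDerivWithinAt.clm_apply hY.hasFDerivWithinAt) hξ]
  simp [dirDeriv, add_comm]

theorem dirDeriv_clm_apply_const {A : V → W →L[ℝ] W'} (hA : DifferentiableWithinAt ℝ A M x)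
    (u : W) (hξ : ξ ∈ tangentAt M x) :
    dirDeriv M (fun y => A y u) x ξ = dirDeriv M A x ξ u := by
  rw [dirDeriv_clm_apply hA (differentiableWithinAt_const u) hξ, dirDeriv_const u hξ, map_zero,
    add_zero]

theorem IsVelocityAt.mem_tangentAt {p ζ : V} {S : Set V} (h : IsVelocityAt S p ζ) :
    ζ ∈ tangentAt S p :=
  Submodule.subset_span h

theorem IsVelocityAt.of_mapsTo {p ζ : V} {S : Set V} {S' : Set W} {U : Set V} {f : V → W}
    {f' : V →L[ℝ] W} (h : IsVelocityAt S p ζ) (hSU : S ⊆ U)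
    (hf : ContDiffOn ℝ ∞ f U) (hf' : HasFDerivAt f f' p) (hS : Set.MapsTo f S S') :
    IsVelocityAt S' (f p) (f' ζ) := by
  obtain ⟨ε, γ, hε, hγ, hγS, h0, hd⟩ := h
  subst h0
  exact ⟨ε, fun t => f (γ t), hε, hf.comp hγ fun t ht => hSU (hγS t ht),
    fun t ht => hS (hγS t ht), rfl, hf'.comp_hasDerivAt 0 hd⟩

theorem tangentAt_mono {S S' : Set V} (h : S ⊆ S') (p : V) : tangentAt S p ≤ tangentAt S' p :=
  Submodule.span_mono fun _ ⟨ε, γ, hε, hγ, hγS, hγd⟩ =>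
    ⟨ε, γ, hε, hγ, fun t ht => h (hγS t ht), hγd⟩

theorem isVelocityAt_of_isOpen {U : Set V} (hU : IsOpen U) (hx : x ∈ U) (ξ : V) :
    IsVelocityAt U x ξ := by
  have hline : ContDiff ℝ ∞ fun t : ℝ => x + t • ξ := by fun_prop
  obtain ⟨ε, hε, hball⟩ := Metric.isOpen_iff.1 (hU.preimage hline.continuous) 0 (by simpa using hx)
  rw [Real.ball_eq_Ioo, zero_sub, zero_add] at hball
  refine ⟨ε, _, hε, hline.contDiffOn, hball, by simp, ?_⟩
  simpa using ((hasDerivAt_id (0 : ℝ)).smul_const ξ).const_add x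

end Along

/-! ### The derivative of a retraction -/

namespace IsRetractionOn

variable {E : Type*} [NormedAddCommGroup E] [NormedSpace ℝ E] {M U : Set E} {r : E → E} {x : E}

theorem contDiffAt (h : IsRetractionOn M U r) (hx : x ∈ U) : ContDiffAt ℝ ∞ r x :=
  h.contDiffOn.contDiffAt (h.isOpen.mem_nhds hx)

theorem hasFDerivAt (h : IsRetractionOn M U r) (hx : x ∈ U) : HasFDerivAt r (fderiv ℝ r x) x :=
  ((h.contDiffAt hx).differentiableAt (by simp)).hasFDerivAt

theorem fderiv_mem_tangentAt (h : IsRetractionOn M U r) (hxM : x ∈ M) (hx : x ∈ U) (u : E) :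
    fderiv ℝ r x u ∈ tangentAt M x := by
  have := (isVelocityAt_of_isOpen h.isOpen hx u).of_mapsTo subset_rfl h.contDiffOn
    (h.hasFDerivAt hx) h.mapsTo
  rw [h.eq_self x hxM hx] at this
  exact this.mem_tangentAt

/-- Along `M` the retraction agrees with the identity. Together with `fderiv_mem_tangentAt` this
makes `fderiv ℝ r` a smooth family of linear projections onto the tangent spaces. -/
theorem fderiv_eq_self (h : IsRetractionOn M U r) (hxM : x ∈ M) (hx : x ∈ U) {ξ : E}
    (hξ : ξ ∈ tangentAt M x) : fderiv ℝ r x ξ = ξ := by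
  rw [← dirDeriv_of_hasFDerivAt (h.hasFDerivAt hx) hξ]
  refine dirDeriv_eq_of_eventuallyEq (g := fun y => y) hxM ?_ (hasFDerivWithinAt_id x M) hξ
  filter_upwards [self_mem_nhdsWithin, mem_nhdsWithin_of_mem_nhds (h.isOpen.mem_nhds hx)]
    with y hyM hy using h.eq_self y hyM hy

theorem contDiffOn_fderiv (h : IsRetractionOn M U r) : ContDiffOn ℝ ∞ (fderiv ℝ r) U :=
  h.contDiffOn.fderiv_of_isOpen h.isOpen (by simp)

/-- Tangent vectors of `M` are velocities. -/
theorem isVelocityAt (h : IsRetractionOn M U r) (hxM : x ∈ M) (hx : x ∈ U) {ξ : E}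
    (hξ : ξ ∈ tangentAt M x) : IsVelocityAt M x ξ := by
  have := (isVelocityAt_of_isOpen h.isOpen hx ξ).of_mapsTo subset_rfl h.contDiffOn
    (h.hasFDerivAt hx) h.mapsTo
  rwa [h.eq_self x hxM hx, h.fderiv_eq_self hxM hx hξ] at this

end IsRetractionOn

/-- The second derivative along `M` of a map defined near `x` is symmetric. -/
theorem dirDeriv_fderiv_comm {V W : Type*} [NormedAddCommGroup V] [NormedSpace ℝ V]
    [NormedAddCommGroup W] [NormedSpace ℝ W] {M U : Set V} {ψ : V → W} {x ξ η : V} (hU : IsOpen U)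
    (hx : x ∈ U) (hψ : ContDiffOn ℝ ∞ ψ U) (hξ : ξ ∈ tangentAt M x) (hη : η ∈ tangentAt M x) :
    dirDeriv M (fderiv ℝ ψ) x ξ η = dirDeriv M (fderiv ℝ ψ) x η ξ := by
  have hat := hψ.contDiffAt (hU.mem_nhds hx)
  have hd : HasFDerivAt (fderiv ℝ ψ) (fderiv ℝ (fderiv ℝ ψ) x) x :=
    ((hat.fderiv_right (m := 1) (by norm_cast)).differentiableAt (by simp)).hasFDerivAt
  rw [dirDeriv_of_hasFDerivAt hd hξ, dirDeriv_of_hasFDerivAt hd hη]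
  exact hat.isSymmSndFDerivAt (by simpa using ENat.LEInfty.out) ξ η

/-- The bracket of two vector fields of `M` is tangent to `M`. -/
theorem bracket_mem_tangentAt {E : Type*} [NormedAddCommGroup E] [InnerProductSpace ℝ E]
    [FiniteDimensional ℝ E] {M : Set E} (hM : IsEmbeddedSubmanifold M) {x : E} (hx : x ∈ M)
    {Y Z : E → E} (hY : DifferentiableWithinAt ℝ Y M x) (hZ : DifferentiableWithinAt ℝ Z M x)
    (hYM : ∀ᶠ y in 𝓝[M] x, Y y ∈ tangentAt M y) (hZM : ∀ᶠ y in 𝓝[M] x, Z y ∈ tangentAt M y) :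
    dirDeriv M Z x (Y x) - dirDeriv M Y x (Z x) ∈ tangentAt M x := by
  obtain ⟨U, r, hr, hxU⟩ := hM.exists_retraction hx
  have hR : DifferentiableWithinAt ℝ (fderiv ℝ r) M x :=
    ((hr.contDiffOn_fderiv.contDiffAt (hr.isOpen.mem_nhds hxU)).differentiableAt
      (by simp)).differentiableWithinAt
  -- This is the derivative of `Y = r' Y` along `M`. In the bracket the two terms in `r''` cancel by
  -- symmetry, leaving `r'` of the bracket.
  have key : ∀ (Y : E → E) (ξ : E), DifferentiableWithinAt ℝ Y M x → ξ ∈ tangentAt M x →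
      (∀ᶠ y in 𝓝[M] x, Y y ∈ tangentAt M y) →
      dirDeriv M Y x ξ = dirDeriv M (fderiv ℝ r) x ξ (Y x) + fderiv ℝ r x (dirDeriv M Y x ξ) := by
    intro Y ξ hY hξ hYM
    rw [← dirDeriv_clm_apply hR hY hξ]
    symm
    refine dirDeriv_eq_of_eventuallyEq hx ?_ hY.hasFDerivWithinAt hξ
    filter_upwards [hYM, self_mem_nhdsWithin, mem_nhdsWithin_of_mem_nhds (hr.isOpen.mem_nhds hxU)]
      with y hy hyM hyU using hr.fderiv_eq_self hyM hyU hy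
  have hYx := hYM.self_of_nhdsWithin hx
  have hZx := hZM.self_of_nhdsWithin hx
  rw [key Z (Y x) hZ hYx hZM, key Y (Z x) hY hZx hYM,
    dirDeriv_fderiv_comm hr.isOpen hxU hr.contDiffOn hYx hZx, add_sub_add_left_eq_sub, ← map_sub]
  exact hr.fderiv_mem_tangentAt hx hxU _

/-! ### Properties of the metric projections -/

section MetricProj

variable {E : Type*} [NormedAddCommGroup E] [InnerProductSpace ℝ E] [FiniteDimensional ℝ E]
  {G : E →L[ℝ] E}

theorem isUnit_of_pos {C : E →L[ℝ] E} (hC : ∀ u : E, u ≠ 0 → 0 < inner ℝ u (C u)) : IsUnit C := by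
  have hinj : Function.Injective C := by
    rw [injective_iff_map_eq_zero]
    intro a ha
    by_contra hne
    have := hC a hne
    rw [ha, inner_zero_right] at this
    exact lt_irrefl _ this
  have hb : Function.Bijective (C : E →ₗ[ℝ] E) :=
    ⟨hinj, LinearMap.injective_iff_surjective.1 hinj⟩
  refine ⟨ContinuousLinearEquiv.toUnit
    (LinearEquiv.ofBijective (C : E →ₗ[ℝ] E) hb).toContinuousLinearEquiv, ?_⟩
  ext a
  rfl

theorem metricProj_unique (hs : ∀ u w : E, inner ℝ (G u) w = inner ℝ u (G w))
    (hp : ∀ u : E, u ≠ 0 → 0 < inner ℝ u (G u)) {W : Submodule ℝ E} {u y : E} (hy : y ∈ W)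
    (h : ∀ η ∈ W, inner ℝ y (G η) = inner ℝ u (G η)) : metricProj G W u = y := by
  by_contra hne
  have hmem := Submodule.sub_mem _ (metricProj_mem G W u) hy
  have h1 := hp _ (sub_ne_zero.2 hne)
  rw [inner_sub_left, inner_metricProj hs hp W u hmem, h _ hmem, sub_self] at h1
  exact lt_irrefl _ h1

theorem metricProj_eq_self (hs : ∀ u w : E, inner ℝ (G u) w = inner ℝ u (G w))
    (hp : ∀ u : E, u ≠ 0 → 0 < inner ℝ u (G u)) {W : Submodule ℝ E} {u : E} (hu : u ∈ W) :
    metricProj G W u = u :=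
  metricProj_unique hs hp hu fun _ _ => rfl

theorem metricProj_eq_zero (hs : ∀ u w : E, inner ℝ (G u) w = inner ℝ u (G w))
    (hp : ∀ u : E, u ≠ 0 → 0 < inner ℝ u (G u)) {W : Submodule ℝ E} {u : E}
    (hu : ∀ η ∈ W, inner ℝ u (G η) = 0) : metricProj G W u = 0 :=
  metricProj_unique hs hp W.zero_mem fun η hη => by rw [inner_zero_left, hu η hη]

/-- The positive operator `Pᵀ G P + (1 - P)ᵀ (1 - P)`. -/
def metricProjAux (G P : E →L[ℝ] E) : E →L[ℝ] E :=
  ContinuousLinearMap.adjoint P ∘L G ∘L P +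
    ContinuousLinearMap.adjoint (ContinuousLinearMap.id ℝ E - P) ∘L
      (ContinuousLinearMap.id ℝ E - P)

theorem isUnit_metricProjAux (hp : ∀ u : E, u ≠ 0 → 0 < inner ℝ u (G u)) (P : E →L[ℝ] E) :
    IsUnit (metricProjAux G P) := by
  refine isUnit_of_pos fun u hu => ?_
  have h1 : inner ℝ u (metricProjAux G P u) =
      inner ℝ (P u) (G (P u)) + inner ℝ (u - P u) (u - P u) := by
    simp only [metricProjAux, add_apply, ContinuousLinearMap.comp_apply,
      inner_add_right, ContinuousLinearMap.adjoint_inner_right]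
    rfl
  rw [h1]
  by_cases h : P u = 0
  · rw [h, inner_zero_left, zero_add, sub_zero]
    exact real_inner_self_pos.2 hu
  · exact add_pos_of_pos_of_nonneg (hp _ h) real_inner_self_nonneg

/-- The metric projection in terms of an arbitrary linear projection `P` onto the subspace. -/
theorem metricProj_eq_of_projection (hs : ∀ u w : E, inner ℝ (G u) w = inner ℝ u (G w))
    (hp : ∀ u : E, u ≠ 0 → 0 < inner ℝ u (G u)) {W : Submodule ℝ E} {P : E →L[ℝ] E}
    (hPW : ∀ u, P u ∈ W) (hP : ∀ u ∈ W, P u = u) :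
    metricProj G W = P ∘L Ring.inverse (metricProjAux G P) ∘L ContinuousLinearMap.adjoint P ∘L G := by
  ext u
  refine metricProj_unique hs hp (hPW _) fun η hη => ?_
  set z := Ring.inverse (metricProjAux G P) (ContinuousLinearMap.adjoint P (G u)) with hz
  have h1 : metricProjAux G P z = ContinuousLinearMap.adjoint P (G u) :=
    DFunLike.congr_fun (Ring.mul_inverse_cancel _ (isUnit_metricProjAux hp P))
      (ContinuousLinearMap.adjoint P (G u))
  -- `P` fixes `η`, so pairing with `η` removes the `(1 - P)` term and both adjoints.
  have h2 := congrArg (fun w => inner ℝ w η) h1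
  simp only [metricProjAux, add_apply, ContinuousLinearMap.comp_apply,
    inner_add_left, ContinuousLinearMap.adjoint_inner_left, sub_apply,
    ContinuousLinearMap.id_apply, hP η hη, sub_self, inner_zero_right, add_zero] at h2
  rw [← hs, ← hs]
  exact h2

/-- The definition of `metricProj` inverts an operator on the varying space `W x`. The formula
through `P` inverts one on the fixed space `E` instead, so smoothness of inversion at units applies.
-/
theorem contDiffOn_metricProj {X : Type*} [NormedAddCommGroup X] [NormedSpace ℝ X] {s : Set X}
    {g P : X → E →L[ℝ] E} {W : X → Submodule ℝ E} (hg : ContDiffOn ℝ ∞ g s)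
    (hP : ContDiffOn ℝ ∞ P s)
    (hs : ∀ x ∈ s, ∀ u w : E, inner ℝ (g x u) w = inner ℝ u (g x w))
    (hp : ∀ x ∈ s, ∀ u : E, u ≠ 0 → 0 < inner ℝ u (g x u))
    (hPW : ∀ x ∈ s, ∀ u, P x u ∈ W x) (hPs : ∀ x ∈ s, ∀ u ∈ W x, P x u = u) :
    ContDiffOn ℝ ∞ (fun x => metricProj (g x) (W x)) s := by
  have hadj : ∀ {Q : X → E →L[ℝ] E}, ContDiffOn ℝ ∞ Q s →
      ContDiffOn ℝ ∞ (fun x => ContinuousLinearMap.adjoint (Q x)) s := fun hQ =>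
    (ContinuousLinearMap.adjoint (𝕜 := ℝ) (E := E)
      (F := E)).toContinuousLinearEquiv.contDiff.comp_contDiffOn hQ
  have h1P : ContDiffOn ℝ ∞ (fun x => ContinuousLinearMap.id ℝ E - P x) s :=
    contDiffOn_const.sub hP
  have haux : ContDiffOn ℝ ∞ (fun x => metricProjAux (g x) (P x)) s :=
    ((hadj hP).clm_comp (hg.clm_comp hP)).add ((hadj h1P).clm_comp h1P)
  have hinv : ContDiffOn ℝ ∞ (fun x => Ring.inverse (metricProjAux (g x) (P x))) s := by
    intro x hx
    obtain ⟨e, he⟩ := isUnit_metricProjAux (hp x hx) (P x)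
    have := contDiffAt_ringInverse ℝ (n := ∞) e
    rw [he] at this
    exact this.comp_contDiffWithinAt x (haux x hx)
  refine (hP.clm_comp (hinv.clm_comp ((hadj hP).clm_comp hg))).congr fun x hx => ?_
  exact metricProj_eq_of_projection (hs x hx) (hp x hx) (hPW x hx) (hPs x hx)

end MetricProj

namespace SubmersedAmbient

variable {E F B : Type*} [NormedAddCommGroup E] [InnerProductSpace ℝ E] [FiniteDimensional ℝ E]
  [NormedAddCommGroup F] [NormedSpace ℝ F] [TopologicalSpace B] [ChartedSpace F B]
  [IsManifold 𝓘(ℝ, F) ∞ B]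

/-! ### The submersion in coordinates -/

/-- The submersion in the preferred chart of `B` at `b`, extended to the domain of a retraction
`r` onto `M`. -/
def coord (S : SubmersedAmbient E F B) (b : B) (r : E → E) (y : E) : F :=
  extChartAt 𝓘(ℝ, F) b (S.q (r y))

/-- The open set `U` is the domain of a retraction `r` onto `M`, and `q` maps `r U` to the chart of
`B` at `b`. -/
structure IsCoordDomain (S : SubmersedAmbient E F B) (b : B) (U : Set E) (r : E → E) : Prop where
  retr : IsRetractionOn S.M U r
  mem_source : ∀ y ∈ U, S.q (r y) ∈ (extChartAt 𝓘(ℝ, F) b).source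

theorem exists_isCoordDomain (S : SubmersedAmbient E F B) {x : E} (hx : x ∈ S.M) :
    ∃ (U : Set E) (r : E → E), S.IsCoordDomain (S.q x) U r ∧ x ∈ U := by
  obtain ⟨U, r, hr, hxU⟩ := S.isSubmanifold.exists_retraction hx
  have hc : ContinuousOn (fun y => S.q (r y)) U :=
    S.q_smooth.continuousOn.comp hr.contDiffOn.continuousOn hr.mapsTo
  have hsub : U ∩ (fun y => S.q (r y)) ⁻¹' (extChartAt 𝓘(ℝ, F) (S.q x)).source ⊆ U :=
    Set.inter_subset_left
  refine ⟨_, r, ⟨⟨hc.isOpen_inter_preimage hr.isOpen (isOpen_extChartAt_source (S.q x)),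
    hr.contDiffOn.mono hsub, hr.mapsTo.mono_left hsub, fun y hy h => hr.eq_self y hy h.1⟩,
    fun y hy => hy.2⟩, hxU, ?_⟩
  change S.q (r x) ∈ (extChartAt 𝓘(ℝ, F) (S.q x)).source
  rw [hr.eq_self x hx hxU]
  exact mem_extChartAt_source (S.q x)

namespace IsCoordDomain

variable {S : SubmersedAmbient E F B} {b : B} {U : Set E} {r : E → E} {y : E}

theorem contDiffOn (h : S.IsCoordDomain b U r) : ContDiffOn ℝ ∞ (S.coord b r) U := by
  have h1 : ContMDiffOn 𝓘(ℝ, E) 𝓘(ℝ, F) ∞ (fun y => S.q (r y)) U :=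
    S.q_smooth.comp h.retr.contDiffOn.contMDiffOn h.retr.mapsTo
  refine ContMDiffOn.contDiffOn (contMDiffOn_extChartAt.comp h1 fun y hy => ?_)
  simpa using h.mem_source y hy

theorem hasFDerivAt (h : S.IsCoordDomain b U r) (hy : y ∈ U) :
    HasFDerivAt (S.coord b r) (fderiv ℝ (S.coord b r) y) y :=
  ((h.contDiffOn.contDiffAt (h.retr.isOpen.mem_nhds hy)).differentiableAt (by simp)).hasFDerivAt

theorem contDiffOn_fderiv (h : S.IsCoordDomain b U r) :
    ContDiffOn ℝ ∞ (fderiv ℝ (S.coord b r)) U :=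
  h.contDiffOn.fderiv_of_isOpen h.retr.isOpen (by simp)

theorem differentiableWithinAt_fderiv (h : S.IsCoordDomain b U r) (hy : y ∈ U) {s : Set E} :
    DifferentiableWithinAt ℝ (fderiv ℝ (S.coord b r)) s y :=
  ((h.contDiffOn_fderiv.contDiffAt (h.retr.isOpen.mem_nhds hy)).differentiableAt
    (by simp)).differentiableWithinAt

theorem coord_eq (h : S.IsCoordDomain b U r) (hyM : y ∈ S.M) (hy : y ∈ U) :
    S.coord b r y = extChartAt 𝓘(ℝ, F) b (S.q y) := by
  rw [coord, h.retr.eq_self y hyM hy]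

theorem q_mem_source (h : S.IsCoordDomain b U r) (hyM : y ∈ S.M) (hy : y ∈ U) :
    S.q y ∈ (extChartAt 𝓘(ℝ, F) b).source := by
  have := h.mem_source y hy
  rwa [h.retr.eq_self y hyM hy] at this

theorem eventually_mem (h : S.IsCoordDomain b U r) (hy : y ∈ U) {s : Set E} :
    ∀ᶠ z in 𝓝[s] y, z ∈ U :=
  mem_nhdsWithin_of_mem_nhds (h.retr.isOpen.mem_nhds hy)

/-- Near `y` one has `r ∘ r = r`, hence `coord ∘ r = coord`; differentiate. -/
theorem fderiv_coord_retr (h : S.IsCoordDomain b U r) (hyM : y ∈ S.M) (hy : y ∈ U) (u : E) :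
    fderiv ℝ (S.coord b r) y (fderiv ℝ r y u) = fderiv ℝ (S.coord b r) y u := by
  have hry := h.retr.eq_self y hyM hy
  have h1 : HasFDerivAt (S.coord b r ∘ r) (fderiv ℝ (S.coord b r) y ∘L fderiv ℝ r y) y := by
    refine HasFDerivAt.comp y ?_ (h.retr.hasFDerivAt hy)
    rw [hry]
    exact h.hasFDerivAt hy
  have h2 : S.coord b r =ᶠ[𝓝 y] S.coord b r ∘ r := by
    have hc : ∀ᶠ z in 𝓝 y, r z ∈ U := by
      refine (h.retr.contDiffAt hy).continuousAt.eventually_mem ?_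
      rw [hry]
      exact h.retr.isOpen.mem_nhds hy
    filter_upwards [hc, h.retr.isOpen.mem_nhds hy] with z hz hzU
    simp only [coord, Function.comp_apply, h.retr.eq_self _ (h.retr.mapsTo hzU) hz]
  exact (DFunLike.congr_fun ((h1.congr_of_eventuallyEq h2).unique (h.hasFDerivAt hy)) u)

end IsCoordDomain

theorem hasFDerivWithinAt_extChartAt_q (S : SubmersedAmbient E F B) {y : E} (hy : y ∈ S.M) :
    HasFDerivWithinAt (fun z => extChartAt 𝓘(ℝ, F) (S.q y) (S.q z))
      (mfderivWithin 𝓘(ℝ, E) 𝓘(ℝ, F) S.q S.M y : E →L[ℝ] F) S.M y := by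
  have h := (((S.q_smooth y hy).mdifferentiableWithinAt (by simp)).hasMFDerivWithinAt).2
  simp only [writtenInExtChartAt, extChartAt_self_eq, modelWithCornersSelf_coe,
    Function.comp_def, id, Set.range_id,
    Set.inter_univ] at h
  exact h

namespace IsCoordDomain

variable {S : SubmersedAmbient E F B} {b : B} {U : Set E} {r : E → E} {y : E}

/-- The manifold derivative at `y` is expressed in the preferred chart at `q y`, while `coord` uses
the fixed chart at `b`; the derivative of the transition map relates them. -/
theorem fderiv_coord_eq (h : S.IsCoordDomain b U r) (hyM : y ∈ S.M) (hy : y ∈ U) {ξ : E}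
    (hξ : ξ ∈ tangentAt S.M y) : fderiv ℝ (S.coord b r) y ξ =
      tangentCoordChange 𝓘(ℝ, F) (S.q y) b (S.q y) (submersionDeriv (F := F) S.M S.q y ξ) := by
  have h1 := S.hasFDerivWithinAt_extChartAt_q hyM
  have h2 := hasFDerivWithinAt_tangentCoordChange (I := 𝓘(ℝ, F)) (x := S.q y) (y := b)
    ⟨mem_extChartAt_source (S.q y), h.q_mem_source hyM hy⟩
  rw [modelWithCornersSelf_coe, Set.range_id, hasFDerivWithinAt_univ] at h2
  have h3 := h2.comp_hasFDerivWithinAt y h1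
  rw [← dirDeriv_of_hasFDerivAt (h.hasFDerivAt hy) hξ]
  refine dirDeriv_eq_of_eventuallyEq hyM ?_ h3 hξ
  have hsrc : ∀ᶠ z in 𝓝[S.M] y, S.q z ∈ (extChartAt 𝓘(ℝ, F) (S.q y)).source :=
    (S.q_smooth.continuousOn y hyM).eventually_mem (extChartAt_source_mem_nhds (S.q y))
  filter_upwards [self_mem_nhdsWithin, h.eventually_mem hy, hsrc] with z hzM hz hzs
  simp only [Function.comp_apply]
  rw [h.coord_eq hzM hz, (extChartAt 𝓘(ℝ, F) (S.q y)).left_inv hzs]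

theorem fderiv_coord_surjective (h : S.IsCoordDomain b U r) (hyM : y ∈ S.M) (hy : y ∈ U) :
    Function.Surjective (fderiv ℝ (S.coord b r) y) := by
  intro w
  obtain ⟨ξ, hξ, hw⟩ := S.deriv_onto y hyM (tangentCoordChange 𝓘(ℝ, F) b (S.q y) (S.q y) w)
  refine ⟨ξ, ?_⟩
  have hs := h.q_mem_source hyM hy
  rw [h.fderiv_coord_eq hyM hy hξ, hw,
    tangentCoordChange_comp ⟨⟨hs, mem_extChartAt_source (S.q y)⟩, hs⟩, tangentCoordChange_self hs]

theorem exists_rightInverse [FiniteDimensional ℝ F] (h : S.IsCoordDomain b U r) (hyM : y ∈ S.M)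
    (hy : y ∈ U) :
    ∃ K : F →L[ℝ] E, fderiv ℝ (S.coord b r) y ∘L K = ContinuousLinearMap.id ℝ F := by
  obtain ⟨K, hK⟩ := (fderiv ℝ (S.coord b r) y).toLinearMap.exists_rightInverse_of_surjective
    (LinearMap.range_eq_top.2 (h.fderiv_coord_surjective hyM hy))
  exact ⟨LinearMap.toContinuousLinearMap K, ContinuousLinearMap.ext fun w => LinearMap.congr_fun hK w⟩

/-- `coord` is constant on the fiber, which gives one direction. For the other, a curve in the level
set of `coord` in `E` with velocity `ξ` is pushed by `r` into the fiber, as the chart is injective,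
and `r'` fixes `ξ`. -/
theorem mem_verticalSpace_iff [FiniteDimensional ℝ F] (h : S.IsCoordDomain b U r) (hyM : y ∈ S.M)
    (hy : y ∈ U) {ξ : E} : ξ ∈ verticalSpace S.M S.q y ↔
      ξ ∈ tangentAt S.M y ∧ fderiv ℝ (S.coord b r) y ξ = 0 := by
  have hym : y ∈ {z ∈ S.M | S.q z = S.q y} := ⟨hyM, rfl⟩
  constructor
  · intro hξ
    refine ⟨tangentAt_mono (fun z hz => hz.1) y hξ, ?_⟩
    rw [← dirDeriv_of_hasFDerivAt (h.hasFDerivAt hy) hξ]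
    refine dirDeriv_of_eventually_const hym ?_ hξ
    filter_upwards [self_mem_nhdsWithin, h.eventually_mem hy] with z hzM hz
    rw [h.coord_eq hzM.1 hz, h.coord_eq hyM hy, hzM.2]
  · rintro ⟨hξ, h0⟩
    obtain ⟨K, hK⟩ := h.exists_rightInverse hyM hy
    have hv := (isVelocityAt_levelSet h.retr.isOpen hy h.contDiffOn hK h0).of_mapsTo
      (S' := {z ∈ S.M | S.q z = S.q y}) (fun z hz => hz.1) h.retr.contDiffOn
      (h.retr.hasFDerivAt hy) ?_
    · rw [h.retr.eq_self y hyM hy, h.retr.fderiv_eq_self hyM hy hξ] at hv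
      exact hv.mem_tangentAt
    · rintro z ⟨hz, hzy⟩
      refine ⟨h.retr.mapsTo hz, (extChartAt 𝓘(ℝ, F) b).injOn (h.mem_source z hz)
        (h.q_mem_source hyM hy) ?_⟩
      rw [← h.coord_eq hyM hy, ← hzy, coord]

end IsCoordDomain

/-! ### The projections -/

section Projections

variable (S : SubmersedAmbient E F B) {x : E}

theorem verticalSpace_le_tangentAt (x : E) : verticalSpace S.M S.q x ≤ tangentAt S.M x :=
  tangentAt_mono (fun _ hz => hz.1) x

theorem hProj_mem (x u : E) : S.hProj x u ∈ horizontalSpace S.toEmbeddedAmbient S.q x :=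
  metricProj_mem _ _ _

theorem vProj_mem (x u : E) : S.vProj x u ∈ verticalSpace S.M S.q x :=
  metricProj_mem _ _ _

theorem tangentProj_mem (x u : E) : S.tangentProj x u ∈ tangentAt S.M x :=
  metricProj_mem _ _ _

variable {S}

theorem tangentProj_eq_self (hx : x ∈ S.M) {u : E} (hu : u ∈ tangentAt S.M x) :
    S.tangentProj x u = u :=
  metricProj_eq_self (S.g_symm x hx) (S.g_pos x hx) hu

theorem hProj_eq_self (hx : x ∈ S.M) {u : E} (hu : u ∈ horizontalSpace S.toEmbeddedAmbient S.q x) :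
    S.hProj x u = u :=
  metricProj_eq_self (S.g_symm x hx) (S.g_pos x hx) hu

theorem vProj_eq_self (hx : x ∈ S.M) {u : E} (hu : u ∈ verticalSpace S.M S.q x) :
    S.vProj x u = u :=
  metricProj_eq_self (S.g_symm x hx) (S.g_pos x hx) hu

theorem hProj_hProj (hx : x ∈ S.M) (u : E) : S.hProj x (S.hProj x u) = S.hProj x u :=
  hProj_eq_self hx (S.hProj_mem x u)

theorem inner_g_of_vertical_of_horizontal {u w : E} (hu : u ∈ verticalSpace S.M S.q x)
    (hw : w ∈ horizontalSpace S.toEmbeddedAmbient S.q x) : inner ℝ u (S.g x w) = 0 :=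
  hw.2 u hu

theorem inner_g_of_horizontal_of_vertical (hx : x ∈ S.M) {u w : E}
    (hu : u ∈ horizontalSpace S.toEmbeddedAmbient S.q x) (hw : w ∈ verticalSpace S.M S.q x) :
    inner ℝ u (S.g x w) = 0 := by
  rw [← S.g_symm x hx, real_inner_comm]
  exact hu.2 w hw

theorem hProj_of_vertical (hx : x ∈ S.M) {u : E} (hu : u ∈ verticalSpace S.M S.q x) :
    S.hProj x u = 0 :=
  metricProj_eq_zero (S.g_symm x hx) (S.g_pos x hx) fun _ hη => inner_g_of_vertical_of_horizontal hu hη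

theorem vProj_of_horizontal (hx : x ∈ S.M) {u : E}
    (hu : u ∈ horizontalSpace S.toEmbeddedAmbient S.q x) : S.vProj x u = 0 :=
  metricProj_eq_zero (S.g_symm x hx) (S.g_pos x hx) fun _ hη => inner_g_of_horizontal_of_vertical hx hu hη

theorem hProj_eq_tangentProj_sub (hx : x ∈ S.M) : S.hProj x = S.tangentProj x - S.vProj x := by
  have hT := fun u {η : E} (hη : η ∈ tangentAt S.M x) =>
    inner_metricProj (S.g_symm x hx) (S.g_pos x hx) (tangentAt S.M x) u hη
  have hV := fun u {η : E} (hη : η ∈ verticalSpace S.M S.q x) =>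
    inner_metricProj (S.g_symm x hx) (S.g_pos x hx) (verticalSpace S.M S.q x) u hη
  ext u
  refine metricProj_unique (S.g_symm x hx) (S.g_pos x hx) ⟨?_, ?_⟩ ?_
  · exact Submodule.sub_mem _ (S.tangentProj_mem x u)
      (S.verticalSpace_le_tangentAt x (S.vProj_mem x u))
  · intro η hη
    rw [← S.g_symm x hx, real_inner_comm, sub_apply, inner_sub_left]
    exact sub_eq_zero.2 ((hT u (S.verticalSpace_le_tangentAt x hη)).trans (hV u hη).symm)
  · intro η hη
    rw [sub_apply, inner_sub_left,
      inner_g_of_vertical_of_horizontal (S.vProj_mem x u) hη, sub_zero]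
    exact hT u hη.1

theorem hProj_add_vProj (hx : x ∈ S.M) (u : E) : S.hProj x u + S.vProj x u = S.tangentProj x u := by
  rw [hProj_eq_tangentProj_sub hx, sub_apply, sub_add_cancel]

theorem hProj_tangentProj (hx : x ∈ S.M) (u : E) : S.hProj x (S.tangentProj x u) = S.hProj x u := by
  rw [← hProj_add_vProj hx, map_add, hProj_hProj hx, hProj_of_vertical hx (S.vProj_mem x u),
    add_zero]

theorem mem_verticalSpace_of_hProj_eq_zero (hx : x ∈ S.M) {u : E} (hu : u ∈ tangentAt S.M x)
    (h : S.hProj x u = 0) : u ∈ verticalSpace S.M S.q x := by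
  have := hProj_add_vProj hx u
  rw [h, zero_add, tangentProj_eq_self hx hu] at this
  exact this ▸ S.vProj_mem x u

variable (S)

theorem contDiffOn_tangentProj : ContDiffOn ℝ ∞ S.tangentProj S.M := by
  intro x hx
  obtain ⟨U, r, hr, hxU⟩ := S.isSubmanifold.exists_retraction hx
  refine (contDiffWithinAt_inter (hr.isOpen.mem_nhds hxU)).1 ?_
  refine contDiffOn_metricProj (s := S.M ∩ U) (P := fderiv ℝ r) (S.g_smooth.mono Set.inter_subset_left)
    (hr.contDiffOn_fderiv.mono Set.inter_subset_right) (fun y hy => S.g_symm y hy.1)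
    (fun y hy => S.g_pos y hy.1) (fun y hy u => hr.fderiv_mem_tangentAt hy.1 hy.2 u)
    (fun y hy u hu => hr.fderiv_eq_self hy.1 hy.2 hu) x ⟨hx, hxU⟩

variable [FiniteDimensional ℝ F]

/-- With `J` the derivative of `coord` and `K` a right inverse of it at `x`, `K (J K)⁻¹` is a right
inverse of `J` at nearby points, smooth in the point. -/
theorem IsCoordDomain.exists_isUnit {S : SubmersedAmbient E F B} {b : B} {U : Set E} {r : E → E}
    (h : S.IsCoordDomain b U r) (hx : x ∈ S.M) (hxU : x ∈ U) :
    ∃ (K : F →L[ℝ] E) (U' : Set E), IsOpen U' ∧ x ∈ U' ∧ U' ⊆ U ∧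
      (∀ y ∈ U', IsUnit (fderiv ℝ (S.coord b r) y ∘L K)) ∧
      ContDiffOn ℝ ∞ (fun y => Ring.inverse (fderiv ℝ (S.coord b r) y ∘L K)) U' := by
  obtain ⟨K, hK⟩ := h.exists_rightInverse hx hxU
  have hJK : ContDiffOn ℝ ∞ (fun y => fderiv ℝ (S.coord b r) y ∘L K) U :=
    h.contDiffOn_fderiv.clm_comp contDiffOn_const
  refine ⟨K, U ∩ (fun y => fderiv ℝ (S.coord b r) y ∘L K) ⁻¹' {C | IsUnit C},
    hJK.continuousOn.isOpen_inter_preimage h.retr.isOpen Units.isOpen, ⟨hxU, ?_⟩,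
    Set.inter_subset_left, fun y hy => hy.2, ?_⟩
  · change IsUnit (fderiv ℝ (S.coord b r) x ∘L K)
    rw [hK]
    exact isUnit_one
  · intro y hy
    obtain ⟨e, he⟩ := hy.2
    have := contDiffAt_ringInverse ℝ (n := ∞) e
    rw [he] at this
    exact this.comp_contDiffWithinAt y ((hJK y hy.1).mono Set.inter_subset_left)

theorem contDiffOn_vProj : ContDiffOn ℝ ∞ S.vProj S.M := by
  intro x hx
  obtain ⟨U, r, h, hxU⟩ := S.exists_isCoordDomain hx
  obtain ⟨K, U', hU', hxU', hsub, hunit, hinv⟩ := h.exists_isUnit hx hxU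
  refine (contDiffWithinAt_inter (hU'.mem_nhds hxU')).1 ?_
  have hR := h.retr.contDiffOn_fderiv.mono hsub
  -- With `J = coord'`, this is `r' (1 - K (J K)⁻¹ J)`. Since `J r' = J`, its values on `E` are
  -- killed by `J`, hence vertical; a vertical vector is killed by `J` and fixed by `r'`, hence
  -- fixed.
  have hP : ContDiffOn ℝ ∞ (fun y => fderiv ℝ r y - fderiv ℝ r y ∘L K ∘L
      Ring.inverse (fderiv ℝ (S.coord (S.q x) r) y ∘L K) ∘L fderiv ℝ (S.coord (S.q x) r) y) U' :=
    hR.sub (hR.clm_comp (contDiffOn_const.clm_comp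
      (hinv.clm_comp (h.contDiffOn_fderiv.mono hsub))))
  refine contDiffOn_metricProj (s := S.M ∩ U') (S.g_smooth.mono Set.inter_subset_left)
    (hP.mono Set.inter_subset_right) (fun y hy => S.g_symm y hy.1)
    (fun y hy => S.g_pos y hy.1) ?_ ?_ x ⟨hx, hxU'⟩
  · rintro y ⟨hyM, hy⟩ u
    refine (h.mem_verticalSpace_iff hyM (hsub hy)).2 ⟨?_, ?_⟩
    · exact Submodule.sub_mem _ (h.retr.fderiv_mem_tangentAt hyM (hsub hy) _)
        (h.retr.fderiv_mem_tangentAt hyM (hsub hy) _)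
    · have h1 : fderiv ℝ (S.coord (S.q x) r) y (K (Ring.inverse (fderiv ℝ (S.coord (S.q x) r) y ∘L K)
          (fderiv ℝ (S.coord (S.q x) r) y u))) = fderiv ℝ (S.coord (S.q x) r) y u :=
        DFunLike.congr_fun (Ring.mul_inverse_cancel _ (hunit y hy)) (fderiv ℝ (S.coord (S.q x) r) y u)
      simp only [sub_apply, map_sub, ContinuousLinearMap.comp_apply,
        h.fderiv_coord_retr hyM (hsub hy), h1, sub_self]
  · rintro y ⟨hyM, hy⟩ u hu
    obtain ⟨huT, hu0⟩ := (h.mem_verticalSpace_iff hyM (hsub hy)).1 hu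
    simp [hu0, h.retr.fderiv_eq_self hyM (hsub hy) huT]

theorem contDiffOn_hProj : ContDiffOn ℝ ∞ S.hProj S.M :=
  (S.contDiffOn_tangentProj.sub S.contDiffOn_vProj).congr fun _ hx => hProj_eq_tangentProj_sub hx

theorem differentiableOn_hProj : DifferentiableOn ℝ S.hProj S.M :=
  S.contDiffOn_hProj.differentiableOn (by simp)

end Projections

end SubmersedAmbient

/-! ### Derivatives along the horizontal bundle and the isometry on horizontal vectors -/

namespace SubmersedAmbient

variable {E F B : Type*} [NormedAddCommGroup E] [InnerProductSpace ℝ E] [FiniteDimensional ℝ E]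
  [NormedAddCommGroup F] [NormedSpace ℝ F] [TopologicalSpace B] [ChartedSpace F B]
  [IsManifold 𝓘(ℝ, F) ∞ B] {S : SubmersedAmbient E F B} {x : E}

theorem fst_mem_tangentAt_of_HM {p ξ : E × E} (hξ : ξ ∈ tangentAt S.HM p) :
    ξ.1 ∈ tangentAt S.M p.1 := by
  unfold tangentAt at hξ
  induction hξ using Submodule.span_induction with
  | mem ζ h =>
    exact (h.of_mapsTo (U := Set.univ) (S' := S.M) (Set.subset_univ _) contDiffOn_fst
      hasFDerivAt_fst fun z hz => hz.1).mem_tangentAt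
  | zero => exact Submodule.zero_mem _
  | add a b _ _ ha hb => exact Submodule.add_mem _ ha hb
  | smul c a _ ha => exact Submodule.smul_mem _ c ha

theorem hasFDerivWithinAt_clm_apply_HM {W : Type*} [NormedAddCommGroup W] [NormedSpace ℝ W]
    {A : E → E →L[ℝ] W} {v : E} (hA : DifferentiableWithinAt ℝ A S.M x) :
    HasFDerivWithinAt (fun p : E × E => A p.1 p.2)
      (A x ∘L ContinuousLinearMap.snd ℝ E E +
        (fderivWithin ℝ A S.M x ∘L ContinuousLinearMap.fst ℝ E E).flip v) S.HM (x, v) := by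
  have h1 : HasFDerivWithinAt (fun p : E × E => A p.1)
      (fderivWithin ℝ A S.M x ∘L ContinuousLinearMap.fst ℝ E E) S.HM (x, v) :=
    HasFDerivWithinAt.comp (g := A) (f := Prod.fst) (x, v) (t := S.M) hA.hasFDerivWithinAt
      hasFDerivWithinAt_fst fun z hz => hz.1
  exact h1.clm_apply hasFDerivWithinAt_snd

theorem hasFDerivWithinAt_g (hx : x ∈ S.M) :
    HasFDerivWithinAt S.g (fderivWithin ℝ S.g S.M x) S.M x :=
  ((S.g_smooth x hx).differentiableWithinAt (by simp)).hasFDerivWithinAt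

theorem oneil_mem (S : SubmersedAmbient E F B) (x ξ η : E) :
    S.oneil x ξ η ∈ verticalSpace S.M S.q x :=
  S.vProj_mem x _

theorem IsCoordDomain.submersionDeriv_eq {b : B} {U : Set E} {r : E → E} {y : E}
    (h : S.IsCoordDomain b U r) (hyM : y ∈ S.M) (hy : y ∈ U) (hb : S.q y = b) {ξ : E}
    (hξ : ξ ∈ tangentAt S.M y) :
    (submersionDeriv (F := F) S.M S.q y ξ : F) = fderiv ℝ (S.coord b r) y ξ := by
  subst hb
  exact ((h.fderiv_coord_eq hyM hy hξ).trans
    (tangentCoordChange_self (mem_extChartAt_source (S.q y)))).symm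

theorem inner_g_self_eq_of_submersionDeriv_eq {y z ξ η : E} (hy : y ∈ S.M) (hz : z ∈ S.M)
    (hξ : ξ ∈ horizontalSpace S.toEmbeddedAmbient S.q y)
    (hη : η ∈ horizontalSpace S.toEmbeddedAmbient S.q z) (hq : S.q y = S.q z)
    (h : (submersionDeriv (F := F) S.M S.q y ξ : F) = submersionDeriv (F := F) S.M S.q z η) :
    inner ℝ ξ (S.g y ξ) = inner ℝ η (S.g z η) := by
  -- The two tangent spaces of `B` are over points only propositionally equal, so the vectors are
  -- compared in `F`.
  have key : ∀ (b b' : B) (u u' : F), b = b' → u = u' →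
      S.metricB.inner b u u = S.metricB.inner b' u' u' := by
    rintro b b' u u' rfl rfl
    rfl
  rw [← S.deriv_isometry y hy ξ hξ ξ hξ, ← S.deriv_isometry z hz η hη η hη]
  exact key _ _ _ _ hq h

variable [FiniteDimensional ℝ F]

/-! ### The derivative of the horizontal projection -/

theorem differentiableWithinAt_hProj (hx : x ∈ S.M) : DifferentiableWithinAt ℝ S.hProj S.M x :=
  S.differentiableOn_hProj x hx

theorem differentiableWithinAt_vProj (hx : x ∈ S.M) : DifferentiableWithinAt ℝ S.vProj S.M x :=
  S.contDiffOn_vProj.differentiableOn (by simp) x hx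

theorem differentiableWithinAt_hProj_apply (hx : x ∈ S.M) (u : E) :
    DifferentiableWithinAt ℝ (fun y => S.hProj y u) S.M x :=
  (differentiableWithinAt_hProj hx).clm_apply (differentiableWithinAt_const u)

theorem dirDeriv_of_eventually_horizontal (hx : x ∈ S.M) {ξ : E} (hξ : ξ ∈ tangentAt S.M x)
    {Y : E → E} (hY : DifferentiableWithinAt ℝ Y S.M x)
    (h : ∀ᶠ y in 𝓝[S.M] x, Y y ∈ horizontalSpace S.toEmbeddedAmbient S.q y) :
    dirDeriv S.M Y x ξ = S.derivHProj x ξ (Y x) + S.hProj x (dirDeriv S.M Y x ξ) := by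
  rw [derivHProj, ← dirDeriv_clm_apply (differentiableWithinAt_hProj hx) hY hξ]
  symm
  refine dirDeriv_eq_of_eventuallyEq hx ?_ hY.hasFDerivWithinAt hξ
  filter_upwards [h, self_mem_nhdsWithin] with y hy hyM using hProj_eq_self hyM hy

/-- The product rule for `H (H u) = H u` with `u` constant. -/
theorem derivHProj_eq (hx : x ∈ S.M) {ξ : E} (hξ : ξ ∈ tangentAt S.M x) (u : E) :
    S.derivHProj x ξ u = S.derivHProj x ξ (S.hProj x u) + S.hProj x (S.derivHProj x ξ u) := by
  have h := dirDeriv_of_eventually_horizontal hx hξ (differentiableWithinAt_hProj_apply hx u)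
    (Filter.Eventually.of_forall fun y => S.hProj_mem y u)
  rwa [dirDeriv_clm_apply_const (differentiableWithinAt_hProj hx) u hξ] at h

theorem hProj_derivHProj_of_horizontal (hx : x ∈ S.M) {ξ η : E} (hξ : ξ ∈ tangentAt S.M x)
    (hη : η ∈ horizontalSpace S.toEmbeddedAmbient S.q x) :
    S.hProj x (S.derivHProj x ξ η) = 0 := by
  have h := derivHProj_eq hx hξ η
  rw [hProj_eq_self hx hη] at h
  simpa using h

/-- This is the bracket of the horizontal fields `y ↦ H_y v` and `y ↦ H_y δ`: it is tangent to `M`,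
and `H` kills both terms because `H ∘ DH ∘ H = 0`. -/
theorem bracket_mem_verticalSpace (hx : x ∈ S.M) {v δ : E}
    (hv : v ∈ horizontalSpace S.toEmbeddedAmbient S.q x)
    (hδ : δ ∈ horizontalSpace S.toEmbeddedAmbient S.q x) :
    S.derivHProj x v δ - S.derivHProj x δ v ∈ verticalSpace S.M S.q x := by
  have hmem : ∀ u : E, ∀ᶠ y in 𝓝[S.M] x, S.hProj y u ∈ tangentAt S.M y := fun u =>
    Filter.Eventually.of_forall fun y => (S.hProj_mem y u).1
  have h := bracket_mem_tangentAt S.isSubmanifold hx (differentiableWithinAt_hProj_apply hx v)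
    (differentiableWithinAt_hProj_apply hx δ) (hmem v) (hmem δ)
  rw [hProj_eq_self hx hv, hProj_eq_self hx hδ,
    dirDeriv_clm_apply_const (differentiableWithinAt_hProj hx) δ hv.1,
    dirDeriv_clm_apply_const (differentiableWithinAt_hProj hx) v hδ.1] at h
  refine mem_verticalSpace_of_hProj_eq_zero hx h ?_
  rw [map_sub]
  exact sub_eq_zero.2 ((hProj_derivHProj_of_horizontal hx hv.1 hδ).trans
    (hProj_derivHProj_of_horizontal hx hδ.1 hv).symm)

/-! ### The tangent spaces of the horizontal bundle -/

theorem mem_tangentAt_HM_iff (hx : x ∈ S.M) {v a b : E}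
    (hv : v ∈ horizontalSpace S.toEmbeddedAmbient S.q x) :
    (a, b) ∈ tangentAt S.HM (x, v) ↔
      a ∈ tangentAt S.M x ∧ b = S.derivHProj x a v + S.hProj x b := by
  constructor
  · intro h
    have ha : (a, b).1 ∈ tangentAt S.M (x, v).1 := fst_mem_tangentAt_of_HM h
    refine ⟨ha, ?_⟩
    have h1 := hasFDerivWithinAt_clm_apply_HM (v := v) (differentiableWithinAt_hProj hx)
    have hev : ∀ᶠ p in 𝓝[S.HM] (x, v), p.2 = S.hProj p.1 p.2 := by
      filter_upwards [self_mem_nhdsWithin] with p hp using (hProj_eq_self hp.1 hp.2).symm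
    have hxv : (x, v) ∈ S.HM := ⟨hx, hv⟩
    have h2 := dirDeriv_eq_of_eventuallyEq (f := fun p : E × E => p.2)
      (g := fun p => S.hProj p.1 p.2) hxv hev h1 h
    refine (dirDeriv_eq hasFDerivWithinAt_snd h).symm.trans (h2.trans ?_)
    rw [add_comm]
    rfl
  · rintro ⟨ha, hb⟩
    obtain ⟨U, r, hr, hxU⟩ := S.isSubmanifold.exists_retraction hx
    obtain ⟨ε, γ, hε, hγ, hγM, h0, hγd⟩ := hr.isVelocityAt hx hxU ha
    subst h0
    have hline : ContDiff ℝ ∞ fun t : ℝ => v + t • b := by fun_prop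
    have hlined : HasDerivAt (fun t : ℝ => v + t • b) b 0 := by
      simpa using ((hasDerivAt_id (0 : ℝ)).smul_const b).const_add v
    have hnhds : Set.Ioo (-ε) ε ∈ 𝓝 (0 : ℝ) := Ioo_mem_nhds (by linarith) hε
    have hH : HasDerivAt (fun t => S.hProj (γ t)) (S.derivHProj (γ 0) a) 0 :=
      ((differentiableWithinAt_hProj hx).hasFDerivWithinAt.comp_hasDerivWithinAt (0 : ℝ)
        hγd.hasDerivWithinAt hγM).hasDerivAt hnhds
    -- Project the line `v + t b` to the horizontal space along a curve `γ` in `M` with velocity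
    -- `a`; its velocity is `(D_a H) v + H b`, which is `b` by hypothesis.
    refine IsVelocityAt.mem_tangentAt
      ⟨ε, fun t => (γ t, S.hProj (γ t) (v + t • b)), hε, ?_, ?_, ?_, ?_⟩
    · exact hγ.prodMk ((S.contDiffOn_hProj.comp hγ hγM).clm_apply hline.contDiffOn)
    · exact fun t ht => ⟨hγM t ht, S.hProj_mem _ _⟩
    · simp [hProj_eq_self hx hv]
    · refine hγd.prodMk ((hH.clm_apply hlined).congr_deriv ?_)
      simpa using hb.symm

theorem mem_THM_iff {v a b : E} : (x, v, a, b) ∈ S.THM ↔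
    x ∈ S.M ∧ v ∈ horizontalSpace S.toEmbeddedAmbient S.q x ∧ a ∈ tangentAt S.M x ∧
      b = S.derivHProj x a v + S.hProj x b := by
  constructor
  · rintro ⟨⟨hx, hv⟩, h⟩
    exact ⟨hx, hv, (mem_tangentAt_HM_iff hx hv).1 h⟩
  · rintro ⟨hx, hv, h⟩
    exact ⟨⟨hx, hv⟩, (mem_tangentAt_HM_iff hx hv).2 h⟩

theorem mem_QHM_iff {v a b : E} : (x, v, a, b) ∈ S.QHM ↔
    x ∈ S.M ∧ v ∈ horizontalSpace S.toEmbeddedAmbient S.q x ∧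
      a ∈ horizontalSpace S.toEmbeddedAmbient S.q x ∧ b = S.derivHProj x a v + S.hProj x b := by
  constructor
  · rintro ⟨h, ha⟩
    obtain ⟨hx, hv, -, hb⟩ := mem_THM_iff.1 h
    exact ⟨hx, hv, ha, hb⟩
  · rintro ⟨hx, hv, ha, hb⟩
    exact ⟨mem_THM_iff.2 ⟨hx, hv, ha.1, hb⟩, ha⟩

/-! ### Range and involutivity of `j_H` -/

theorem jH_mem_QHM {p : E × E × E × E} (hp : p ∈ S.THM) : S.jH p ∈ S.QHM := by
  obtain ⟨x, v, a, b⟩ := p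
  obtain ⟨hx, hv, ha, hb⟩ := mem_THM_iff.1 hp
  refine mem_QHM_iff.2 ⟨hx, S.hProj_mem x a, hv, ?_⟩
  change S.derivHProj x v a + S.hProj x b = S.derivHProj x v (S.hProj x a) +
    S.hProj x (S.derivHProj x v a + S.hProj x b)
  rw [map_add, hProj_hProj hx, ← add_assoc, ← derivHProj_eq hx hv.1]

theorem jH_jH {p : E × E × E × E} (hp : p ∈ S.QHM) : S.jH (S.jH p) = p := by
  obtain ⟨x, v, a, b⟩ := p
  obtain ⟨hx, hv, ha, hb⟩ := mem_QHM_iff.1 hp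
  have h1 : S.hProj x a = a := hProj_eq_self hx ha
  have h2 : S.hProj x v = v := hProj_eq_self hx hv
  have h3 := hProj_derivHProj_of_horizontal hx hv.1 ha
  simp only [jH, h1, h2, map_add, h3, zero_add, hProj_hProj hx, ← hb]

/-! ### The O'Neil tensor -/

/-- A horizontal vector extends to a basic vector field. -/
theorem IsCoordDomain.exists_basic {b : B} {U : Set E} {r : E → E} (h : S.IsCoordDomain b U r)
    (hx : x ∈ S.M) (hxU : x ∈ U) {v : E} (hv : v ∈ horizontalSpace S.toEmbeddedAmbient S.q x) :
    ∃ X : E → E, DifferentiableWithinAt ℝ X S.M x ∧ X x = v ∧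
      (∀ y, X y ∈ horizontalSpace S.toEmbeddedAmbient S.q y) ∧
      ∀ᶠ y in 𝓝[S.M] x, fderiv ℝ (S.coord b r) y (X y) = fderiv ℝ (S.coord b r) x v := by
  obtain ⟨K, U', hU', hxU', hsub, hunit, hinv⟩ := h.exists_isUnit hx hxU
  set w := fderiv ℝ (S.coord b r) x v with hw
  -- `K (J K)⁻¹ w` is a lift of `w` by `J = coord'`; `r'` makes it tangent to `M` and `H` makes it
  -- horizontal, neither changing its image under `J`.
  set X : E → E := fun y => S.hProj y (fderiv ℝ r y
    (K (Ring.inverse (fderiv ℝ (S.coord b r) y ∘L K) w))) with hX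
  have hJX : ∀ y ∈ S.M, y ∈ U' → fderiv ℝ (S.coord b r) y (X y) = w := by
    intro y hyM hy
    set u := K (Ring.inverse (fderiv ℝ (S.coord b r) y ∘L K) w) with hu
    have h1 : fderiv ℝ (S.coord b r) y u = w :=
      DFunLike.congr_fun (Ring.mul_inverse_cancel _ (hunit y hy)) w
    have h2 := ((h.mem_verticalSpace_iff hyM (hsub hy)).1 (S.vProj_mem y (fderiv ℝ r y u))).2
    have h3 := hProj_add_vProj hyM (fderiv ℝ r y u)
    rw [tangentProj_eq_self hyM (h.retr.fderiv_mem_tangentAt hyM (hsub hy) u)] at h3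
    have h4 := congrArg (fderiv ℝ (S.coord b r) y) h3
    rwa [map_add, h2, add_zero, h.fderiv_coord_retr hyM (hsub hy), h1] at h4
  have hmem : ∀ y, X y ∈ horizontalSpace S.toEmbeddedAmbient S.q y := fun y => S.hProj_mem y _
  refine ⟨X, ?_, ?_, hmem, ?_⟩
  · have hn := hU'.mem_nhds hxU'
    have hR := (h.retr.contDiffOn_fderiv.mono hsub).contDiffAt hn
    have hI := hinv.contDiffAt hn
    exact (differentiableWithinAt_hProj hx).clm_apply
      ((hR.differentiableAt (by simp)).differentiableWithinAt.clm_apply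
        (K.differentiableAt.comp_differentiableWithinAt x
          ((hI.differentiableAt (by simp)).differentiableWithinAt.clm_apply
            (differentiableWithinAt_const w))))
  -- `X x` and `v` are horizontal with the same image, so their difference is both horizontal and
  -- vertical.
  · have hsubm := Submodule.sub_mem _ (hmem x) hv
    have hvert : X x - v ∈ verticalSpace S.M S.q x :=
      (h.mem_verticalSpace_iff hx hxU).2 ⟨hsubm.1, by rw [map_sub, hJX x hx hxU', hw, sub_self]⟩
    have := hProj_of_vertical hx hvert
    rwa [hProj_eq_self hx hsubm, sub_eq_zero] at this
  · filter_upwards [self_mem_nhdsWithin, mem_nhdsWithin_of_mem_nhds (hU'.mem_nhds hxU')]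
      with y hyM hy using hJX y hyM hy

/-- By `inner_oneil` the left side is `⟨A_v v, g η⟩`. Extend `v` to a basic field `X` and `η` to the
vertical field `Y = V η`: then `⟨X, Y⟩_g = 0`, `⟨X, X⟩_g` is constant along the fiber, and `[X, Y]`
is vertical. Together these force the vanishing. -/
theorem inner_derivHProj_self (hx : x ∈ S.M) {v η : E}
    (hv : v ∈ horizontalSpace S.toEmbeddedAmbient S.q x) (hη : η ∈ verticalSpace S.M S.q x) :
    inner ℝ (S.derivHProj x v v) (S.g x η) + inner ℝ (dirDeriv S.M S.g x v v) η -
      (1 / 2 : ℝ) * inner ℝ (dirDeriv S.M S.g x η v) v = 0 := by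
  obtain ⟨U, r, h, hxU⟩ := S.exists_isCoordDomain hx
  obtain ⟨X, hXd, hXx, hXh, hXb⟩ := h.exists_basic hx hxU hv
  have hηT := S.verticalSpace_le_tangentAt x hη
  have hVη : S.vProj x η = η := vProj_eq_self hx hη
  have hYd : DifferentiableWithinAt ℝ (fun y => S.vProj y η) S.M x :=
    (differentiableWithinAt_vProj hx).clm_apply (differentiableWithinAt_const η)
  set DY := dirDeriv S.M (fun y => S.vProj y η) x v with hDY
  set DX := dirDeriv S.M X x η with hDX
  have h1 : inner ℝ (dirDeriv S.M X x v) (S.g x η) +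
      (inner ℝ v (dirDeriv S.M S.g x v η) + inner ℝ v (S.g x DY)) = 0 := by
    have hd := hXd.hasFDerivWithinAt.inner ℝ
      ((hasFDerivWithinAt_g hx).clm_apply hYd.hasFDerivWithinAt)
    have h0 := dirDeriv_eq_of_eventuallyEq (f := fun _ => (0 : ℝ)) hx (by
      filter_upwards [self_mem_nhdsWithin] with y hy using
        (inner_g_of_horizontal_of_vertical hy (hXh y) (S.vProj_mem y η)).symm) hd hv.1
    rw [dirDeriv_const _ hv.1] at h0
    simp [hXx, hVη, inner_add_right] at h0
    simp only [hDY, dirDeriv]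
    linarith
  -- Differentiated within the fiber only, where `⟨X, g X⟩` is the squared norm of a fixed vector of
  -- `B`.
  have h2 : 2 * inner ℝ v (S.g x DX) + inner ℝ v (dirDeriv S.M S.g x η v) = 0 := by
    have hd := hXd.hasFDerivWithinAt.inner ℝ
      ((hasFDerivWithinAt_g hx).clm_apply hXd.hasFDerivWithinAt)
    have hsub : {y ∈ S.M | S.q y = S.q x} ⊆ S.M := fun y hy => hy.1
    have h0 := dirDeriv_eq (hd.mono hsub) hη
    rw [dirDeriv_of_eventually_const (show x ∈ {y ∈ S.M | S.q y = S.q x} from ⟨hx, rfl⟩) ?_ hη] at h0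
    · have hsymm := S.g_symm x hx DX v
      simp [hXx, inner_add_right] at h0
      simp only [hDX, dirDeriv] at hsymm ⊢
      rw [real_inner_comm] at hsymm
      linarith
    · filter_upwards [self_mem_nhdsWithin, h.eventually_mem hxU, nhdsWithin_mono x hsub hXb]
        with y hyM hy hyX
      refine inner_g_self_eq_of_submersionDeriv_eq hyM.1 hx (hXh y) (hXh x) hyM.2 ?_
      rw [h.submersionDeriv_eq hyM.1 hy hyM.2 (hXh y).1, h.submersionDeriv_eq hx hxU rfl (hXh x).1,
        hyX, hXx]
  -- With `J = coord'`, differentiate `J Y = 0` along `v` and `J X = const` along `η`; symmetry of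
  -- the second derivative of `coord` leaves `J (DY - DX) = 0`.
  have h3 : DY - DX ∈ verticalSpace S.M S.q x := by
    refine (h.mem_verticalSpace_iff hx hxU).2 ⟨?_, ?_⟩
    · have := bracket_mem_tangentAt S.isSubmanifold hx hXd hYd
        (Filter.Eventually.of_forall fun y => (hXh y).1)
        (Filter.Eventually.of_forall fun y => S.verticalSpace_le_tangentAt y (S.vProj_mem y η))
      rwa [hXx, hVη] at this
    · have hJ := h.differentiableWithinAt_fderiv hxU (s := S.M)
      have e1 := dirDeriv_clm_apply hJ hYd hv.1
      have e2 := dirDeriv_clm_apply hJ hXd hηT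
      rw [dirDeriv_of_eventually_const hx (by rw [hXx]; exact hXb) hηT, hXx] at e2
      have e3 : ∀ᶠ y in 𝓝[S.M] x, fderiv ℝ (S.coord (S.q x) r) y (S.vProj y η) = 0 := by
        filter_upwards [self_mem_nhdsWithin, h.eventually_mem hxU] with y hyM hy using
          ((h.mem_verticalSpace_iff hyM hy).1 (S.vProj_mem y η)).2
      rw [dirDeriv_of_eventually_const hx (by rw [e3.self_of_nhdsWithin hx]; exact e3) hv.1,
        hVη, dirDeriv_fderiv_comm h.retr.isOpen hxU h.contDiffOn hv.1 hηT] at e1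
      have e4 := e1.symm.trans e2
      rw [map_sub]
      exact sub_eq_zero.2 (add_left_cancel e4)
  have h4 : inner ℝ v (S.g x DY) = inner ℝ v (S.g x DX) := by
    have := inner_g_of_horizontal_of_vertical hx hv h3
    rwa [map_sub, inner_sub_right, sub_eq_zero] at this
  have h5 : inner ℝ (dirDeriv S.M X x v) (S.g x η) = inner ℝ (S.derivHProj x v v) (S.g x η) := by
    rw [dirDeriv_of_eventually_horizontal hx hv.1 hXd (Filter.Eventually.of_forall hXh), hXx,
      inner_add_left, inner_g_of_horizontal_of_vertical hx (S.hProj_mem x _) hη, add_zero]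
  have h6 := S.dirDeriv_g_symm hx hv.1 v η
  rw [real_inner_comm] at h6
  rw [h5] at h1
  have h7 := real_inner_comm η (dirDeriv S.M S.g x v v)
  have h8 := real_inner_comm v (dirDeriv S.M S.g x v η)
  have h9 := real_inner_comm v (dirDeriv S.M S.g x η v)
  linarith

theorem inner_oneil (hx : x ∈ S.M) (ξ : E) (hξ : ξ ∈ tangentAt S.M x) (η : E) {u : E}
    (hu : u ∈ verticalSpace S.M S.q x) :
    inner ℝ (S.oneil x ξ η) (S.g x u) = inner ℝ (S.derivHProj x ξ (S.hProj x η)) (S.g x u) +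
      (1 / 2 : ℝ) * (inner ℝ (dirDeriv S.M S.g x ξ (S.hProj x η)) u +
        inner ℝ (dirDeriv S.M S.g x (S.hProj x η) ξ) u -
        inner ℝ (dirDeriv S.M S.g x u ξ) (S.hProj x η)) := by
  rw [oneil, vProj, inner_metricProj (S.g_symm x hx) (S.g_pos x hx) _ _ hu,
    S.inner_covDeriv hx ξ _ (S.verticalSpace_le_tangentAt x hu), hProj_tangentProj hx,
    dirDeriv_congr (fun y hy => hProj_tangentProj hy η) hx,
    dirDeriv_clm_apply_const (differentiableWithinAt_hProj hx) η hξ]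
  change inner ℝ (S.derivHProj x ξ η) _ + _ = _
  rw [derivHProj_eq hx hξ η, inner_add_left,
    inner_g_of_horizontal_of_vertical hx (S.hProj_mem x _) hu, add_zero]

/-- Both sides are vertical, so it suffices to pair with vertical vectors. In `inner_oneil` the
metric terms are symmetric in the two horizontal arguments, and polarizing `inner_derivHProj_self`
evaluates exactly that symmetric part. -/
theorem two_smul_oneil (hx : x ∈ S.M) {v : E} (hv : v ∈ horizontalSpace S.toEmbeddedAmbient S.q x)
    (η : E) : (2 : ℝ) • S.oneil x v η =
      S.derivHProj x v (S.hProj x η) - S.derivHProj x (S.hProj x η) v := by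
  set δ := S.hProj x η with hδ
  have hδh : δ ∈ horizontalSpace S.toEmbeddedAmbient S.q x := S.hProj_mem x η
  have hb := bracket_mem_verticalSpace hx hv hδh
  have hd := Submodule.sub_mem _ (Submodule.smul_mem _ (2 : ℝ) (S.oneil_mem x v η)) hb
  have key : ∀ u ∈ verticalSpace S.M S.q x, inner ℝ ((2 : ℝ) • S.oneil x v η -
      (S.derivHProj x v δ - S.derivHProj x δ v)) (S.g x u) = 0 := by
    intro u hu
    have e1 := inner_derivHProj_self hx hv hu
    have e2 := inner_derivHProj_self hx hδh hu
    -- Polarization: the identity at `v + δ` minus those at `v` and at `δ`.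
    have e3 := inner_derivHProj_self hx (Submodule.add_mem _ hv hδh) hu
    have e4 := S.dirDeriv_g_symm hx (S.verticalSpace_le_tangentAt x hu) v δ
    simp only [derivHProj, dirDeriv, map_add, add_apply, inner_add_left, inner_add_right]
      at e1 e2 e3 e4
    rw [inner_sub_left, inner_sub_left, real_inner_smul_left, inner_oneil hx v hv.1 η hu, ← hδ]
    simp only [derivHProj, dirDeriv]
    linarith
  by_contra hne
  have := S.g_pos x hx _ (sub_ne_zero.2 hne)
  rw [key _ hd] at this
  exact lt_irrefl _ this

/-- Tangency gives `H b = b - (D_a H) v`, so the last entry is `b + (D_v H) a - (D_a H) v`. Split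
`a` into `H a + V a`: the horizontal part contributes `2 A_v a`, the vertical part the correction.
-/
theorem jH_eq {v a b : E} (hp : (x, v, a, b) ∈ S.THM) :
    S.jH (x, v, a, b) = (x, S.hProj x a, v, (2 : ℝ) • S.oneil x v a + b -
      (S.derivHProj x (S.vProj x a) v - S.derivHProj x v (S.vProj x a))) := by
  obtain ⟨hx, hv, ha, hb⟩ := mem_THM_iff.1 hp
  have h1 : a = S.hProj x a + S.vProj x a := by
    rw [hProj_add_vProj hx, tangentProj_eq_self hx ha]
  have h2 : S.derivHProj x v a = S.derivHProj x v (S.hProj x a) + S.derivHProj x v (S.vProj x a) := by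
    rw [← map_add, ← h1]
  have h3 : S.derivHProj x a v = S.derivHProj x (S.hProj x a) v + S.derivHProj x (S.vProj x a) v := by
    have : S.derivHProj x (S.hProj x a + S.vProj x a) v = _ :=
      DFunLike.congr_fun (map_add (fderivWithin ℝ S.hProj S.M x) (S.hProj x a) (S.vProj x a)) v
    rwa [← h1] at this
  have h4 : S.derivHProj x v a + S.hProj x b = (2 : ℝ) • S.oneil x v a + b -
      (S.derivHProj x (S.vProj x a) v - S.derivHProj x v (S.vProj x a)) := by
    rw [two_smul_oneil hx hv, h2]
    nth_rewrite 2 [hb]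
    rw [h3]
    abel
  simp only [jH, h4]

theorem jH_eq_of_mem_QHM {v a b : E} (hp : (x, v, a, b) ∈ S.QHM) :
    S.jH (x, v, a, b) = (x, S.hProj x a, v, (2 : ℝ) • S.oneil x v a + b) := by
  obtain ⟨hx, hv, ha, hb⟩ := mem_QHM_iff.1 hp
  rw [jH_eq hp.1, vProj_of_horizontal hx ha]
  simp [derivHProj, dirDeriv]

end SubmersedAmbient

namespace SubmersedAmbient

variable {E F B : Type*} [NormedAddCommGroup E] [InnerProductSpace ℝ E] [FiniteDimensional ℝ E]
  [NormedAddCommGroup F] [NormedSpace ℝ F] [TopologicalSpace B] [ChartedSpace F B]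
  [IsManifold 𝓘(ℝ, F) ∞ B] {S : SubmersedAmbient E F B} {x : E}

/-! ### The second differential of the submersion in coordinates -/

namespace IsCoordDomain

variable {b : B} {U : Set E} {r : E → E}

theorem trivializationAt_dq (h : S.IsCoordDomain b U r) {p : E × E} (hp : p ∈ S.HM)
    (hU : p.1 ∈ U) : (trivializationAt F (TangentSpace 𝓘(ℝ, F)) b (S.dq p)).2 =
      fderiv ℝ (S.coord b r) p.1 p.2 :=
  (h.fderiv_coord_eq hp.1 hU hp.2.1).symm

theorem eventually_fst_mem (h : S.IsCoordDomain b U r) {p : E × E} (hp : p.1 ∈ U)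
    (s : Set (E × E)) : ∀ᶠ z in 𝓝[s] p, z.1 ∈ U :=
  mem_nhdsWithin_of_mem_nhds (continuous_fst.continuousAt.preimage_mem_nhds
    (h.retr.isOpen.mem_nhds hp))

theorem hasFDerivWithinAt_coords_HM (h : S.IsCoordDomain b U r) {p : E × E}
    (hU : p.1 ∈ U) :
    HasFDerivWithinAt (fun z : E × E => fderiv ℝ (S.coord b r) z.1 z.2)
      (fderiv ℝ (S.coord b r) p.1 ∘L ContinuousLinearMap.snd ℝ E E +
        (fderivWithin ℝ (fderiv ℝ (S.coord b r)) S.M p.1 ∘L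
          ContinuousLinearMap.fst ℝ E E).flip p.2) S.HM p :=
  hasFDerivWithinAt_clm_apply_HM (h.differentiableWithinAt_fderiv hU)

end IsCoordDomain

theorem mdifferentiableOn_dq (S : SubmersedAmbient E F B) :
    MDifferentiableOn 𝓘(ℝ, E × E) 𝓘(ℝ, F).tangent S.dq S.HM := by
  rintro ⟨x, v⟩ hp
  obtain ⟨U, r, h, hxU⟩ := S.exists_isCoordDomain hp.1
  refine (mdifferentiableWithinAt_totalSpace 𝓘(ℝ, F) S.dq).2 ⟨?_, ?_⟩
  · have h1 : MDifferentiableWithinAt 𝓘(ℝ, E) 𝓘(ℝ, F) S.q S.M x :=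
      (S.q_smooth x hp.1).mdifferentiableWithinAt (by simp)
    have h2 : MDifferentiableWithinAt 𝓘(ℝ, E × E) 𝓘(ℝ, E) Prod.fst S.HM (x, v) :=
      differentiableWithinAt_fst.mdifferentiableWithinAt
    exact MDifferentiableWithinAt.comp (g := S.q) (f := Prod.fst) (x, v) h1 h2 fun z hz => hz.1
  · refine MDifferentiableWithinAt.congr_of_eventuallyEq
      (h.hasFDerivWithinAt_coords_HM (p := (x, v)) hxU).differentiableWithinAt.mdifferentiableWithinAt
      ?_ (h.trivializationAt_dq hp hxU)
    filter_upwards [self_mem_nhdsWithin, h.eventually_fst_mem (p := (x, v)) hxU S.HM]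
      with z hz hzU using h.trivializationAt_dq hz hzU

/-- In coordinates `dq` is `(y, u) ↦ (ψ y, ψ'_y u)` with `ψ = coord`; the product rule gives its
derivative. -/
theorem mfderivWithin_dq {U : Set E} {r : E → E} {v a c : E}
    (h : S.IsCoordDomain (S.q x) U r) (hxU : x ∈ U) (hp : (x, v, a, c) ∈ S.THM) :
    (mfderivWithin 𝓘(ℝ, E × E) 𝓘(ℝ, F).tangent S.dq S.HM (x, v) (a, c) : F × F) =
      (fderiv ℝ (S.coord (S.q x) r) x a,
        dirDeriv S.M (fderiv ℝ (S.coord (S.q x) r)) x a v + fderiv ℝ (S.coord (S.q x) r) x c) := by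
  obtain ⟨hxv, hac⟩ := hp
  have h1 := (S.mdifferentiableOn_dq (x, v) hxv).hasMFDerivWithinAt.2
  simp only [writtenInExtChartAt, extChartAt_self_eq, modelWithCornersSelf_coe,
    Function.comp_def, id, Set.range_id, Set.inter_univ] at h1
  have h0 : HasFDerivWithinAt (fun z : E × E => S.coord (S.q x) r z.1)
      (fderiv ℝ (S.coord (S.q x) r) x ∘L ContinuousLinearMap.fst ℝ E E) S.HM (x, v) :=
    HasFDerivAt.comp_hasFDerivWithinAt (g := S.coord (S.q x) r) (f := Prod.fst) (x, v)
      (h.hasFDerivAt hxU) hasFDerivWithinAt_fst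
  have h2 : HasFDerivWithinAt (fun z : E × E => (S.coord (S.q x) r z.1,
      fderiv ℝ (S.coord (S.q x) r) z.1 z.2)) _ S.HM (x, v) :=
    h0.prodMk (h.hasFDerivWithinAt_coords_HM (p := (x, v)) hxU)
  have h3 : ∀ᶠ z in 𝓝[S.HM] (x, v), (extChartAt 𝓘(ℝ, F).tangent (S.dq (x, v)) (S.dq z) : F × F) =
      (S.coord (S.q x) r z.1, fderiv ℝ (S.coord (S.q x) r) z.1 z.2) := by
    filter_upwards [self_mem_nhdsWithin, h.eventually_fst_mem (p := (x, v)) hxU S.HM] with z hz hzU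
    -- The chart of `TB` at `dq (x, v)` is built from the chart of `B` at `q x` and the
    -- trivialization there, so it does not depend on `v`. This is why the same coordinates serve
    -- before and after the flip.
    rw [FiberBundle.extChartAt]
    exact Prod.ext (h.coord_eq hz.1 hzU).symm (h.trivializationAt_dq hz hzU)
  have h4 := dirDeriv_eq_of_eventuallyEq hxv h3 h2 hac
  refine (dirDeriv_eq h1 hac).symm.trans (h4.trans ?_)
  refine Prod.ext rfl ?_
  exact add_comm _ _

theorem d2q_jH [FiniteDimensional ℝ F] {p : E × E × E × E} (hp : p ∈ S.QHM) :
    S.d2q (S.jH p) = canonicalFlip (S.d2q p) := by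
  have hj := jH_mem_QHM hp.1
  obtain ⟨x, v, a, c⟩ := p
  obtain ⟨hx, hv, ha, hc⟩ := mem_QHM_iff.1 hp
  rw [jH_eq_of_mem_QHM hp, hProj_eq_self hx ha] at hj ⊢
  obtain ⟨U, r, h, hxU⟩ := S.exists_isCoordDomain hx
  have e1 := mfderivWithin_dq h hxU hp.1
  have e2 := mfderivWithin_dq h hxU hj.1
  -- The O'Neil term is vertical, so it disappears in `B`; what remains differs from the flipped
  -- vector only by the order of arguments in the second derivative.
  have hA : fderiv ℝ (S.coord (S.q x) r) x ((2 : ℝ) • S.oneil x v a) = 0 :=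
    ((h.mem_verticalSpace_iff hx hxU).1 (Submodule.smul_mem _ _ (S.oneil_mem x v a))).2
  rw [map_add, hA, zero_add,
    dirDeriv_fderiv_comm h.retr.isOpen hxU h.contDiffOn hv.1 ha.1] at e2
  have ea := h.submersionDeriv_eq hx hxU rfl ha.1
  have ev := h.submersionDeriv_eq hx hxU rfl hv.1
  have key : ∀ (u u' : F) (w w' : F × F), u = u' → w = w' →
      (⟨(⟨S.q x, u⟩ : TangentBundle 𝓘(ℝ, F) B), w⟩ :
        TangentBundle 𝓘(ℝ, F).tangent (TangentBundle 𝓘(ℝ, F) B)) =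
        ⟨(⟨S.q x, u'⟩ : TangentBundle 𝓘(ℝ, F) B), w'⟩ := by
    rintro u u' w w' rfl rfl
    rfl
  refine key _ _ _ _ (ea.trans (congrArg Prod.fst e1).symm) (e2.trans ?_)
  exact Prod.ext ev.symm (congrArg Prod.snd e1).symm

end SubmersedAmbient

end HorizontalFlip

end

theorem mainTheorem8 {E F B : Type*} [NormedAddCommGroup E] [InnerProductSpace ℝ E]
    [FiniteDimensional ℝ E] [NormedAddCommGroup F] [NormedSpace ℝ F] [FiniteDimensional ℝ F]
    [TopologicalSpace B] [ChartedSpace F B] [IsManifold 𝓘(ℝ, F) ∞ B]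
    (S : HorizontalFlip.SubmersedAmbient E F B) :
    -- the derivatives that occur below exist
    DifferentiableOn ℝ S.hProj S.M ∧
    MDifferentiableOn 𝓘(ℝ, E × E) 𝓘(ℝ, F).tangent S.dq S.HM ∧
    -- `j_H` maps `THM` into `QHM`
    (∀ p ∈ S.THM, S.jH p ∈ S.QHM) ∧
    -- the last component of `j_H` in terms of the O'Neil tensor, on `THM` and on `QHM`
    (∀ x v Δm Δt : E, (x, v, Δm, Δt) ∈ S.THM →
      S.jH (x, v, Δm, Δt) = (x, S.hProj x Δm, v, (2 : ℝ) • S.oneil x v Δm + Δt -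
        (S.derivHProj x (S.vProj x Δm) v - S.derivHProj x v (S.vProj x Δm)))) ∧
    (∀ x v δm δt : E, (x, v, δm, δt) ∈ S.QHM →
      S.jH (x, v, δm, δt) = (x, S.hProj x δm, v, (2 : ℝ) • S.oneil x v δm + δt)) ∧
    -- `j_H` is an involution on `QHM`
    (∀ p ∈ S.QHM, S.jH (S.jH p) = p) ∧
    -- `j_H` corresponds under `d²q` to the canonical flip of the double tangent bundle of `B`
    (∀ p ∈ S.QHM, S.d2q (S.jH p) = HorizontalFlip.canonicalFlip (S.d2q p)) :=
  ⟨S.differentiableOn_hProj, S.mdifferentiableOn_dq,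
    fun _ hp => HorizontalFlip.SubmersedAmbient.jH_mem_QHM hp,
    fun _ _ _ _ hp => HorizontalFlip.SubmersedAmbient.jH_eq hp,
    fun _ _ _ _ hp => HorizontalFlip.SubmersedAmbient.jH_eq_of_mem_QHM hp,
    fun _ hp => HorizontalFlip.SubmersedAmbient.jH_jH hp,
    fun _ hp => HorizontalFlip.SubmersedAmbient.d2q_jH hp⟩
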